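/- Let $\omega,c\in\mathbb{R}$ satisfy $\omega>c^2/4$, or $\omega=c^2/4$ and $c>0$. Put $$\alpha_0=\tfrac13\bigl(4c+\sqrt{48\omega+4c^2}\bigr),\qquad A(x)=-3x^2+8cx+64\omega,\qquad L_0=L_0(\omega,c)=\frac{2\pi}{\sqrt{\alpha_0\sqrt{A(\alpha_0)}}},$$ and let $\Phi_{\omega,c}>0$ be the soliton on $\mathbb{R}$ given by $$\Phi_{\omega,c}^2(x)=\frac{4\omega-c^2}{\sqrt\omega\,\bigl(\cosh(\sqrt{4\omega-c^2}\,x)-\frac{c}{2\sqrt\omega}\bigr)}\ \text{ if }\omega>\tfrac{c^2}{4},\qquad \Phi_{\omega,c}^2(x)=\frac{4c}{(cx)^2+1}\ \text{ if }\omega=\tfrac{c^2}{4},\ c>0 .$$ For $L>0$ consider, on the torus $\mathbb{T}_{2L}=\mathbb{R}/2L\mathbb{Z}$, the equation $$-\Phi''+\Bigl(\omega-\frac{c^2}{4}\Bigr)\Phi+\frac c2|\Phi|^2\Phi-\frac3{16}|\Phi|^4\Phi=0 .\tag{ELL}$$ A real $2L$-periodic function is called single-bump if over one period it first decreases strictly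 from its maximum to its minimum and then increases strictly back to its maximum. For $k\in(0,1)$ let $F(\varphi,k)=\int_0^\varphi\frac{d\theta}{\sqrt{1-k^2\sin^2\theta}}$, $K(k)=F(\pi/2,k)$, and, for $u=F(\varphi,k)$, $\mathrm{sn}(u;k)=\sin\varphi$ and $\mathrm{dn}(u;k)=\sqrt{1-k^2\,\mathrm{sn}^2(u;k)}$. Then $L_0>0$, and for every $L>L_0$ there is a positive single-bump $C^2$ solution $\Phi^L_{\omega,c}$ of (ELL) on $\mathbb{T}_{2L}$; every positive single-bump $C^2$ solution of (ELL) on $\mathbb{T}_{2L}$ is a translate of it. It is given explicitly, for all $x\in\mathbb{R}$, by $$\bigl(\Phi^L_{\omega,c}(x)\bigr)^2=\eta_3\,\frac{\mathrm{dn}^2\bigl(\frac{x}{2g};k\bigr)}{1+\beta^2\,\mathrm{sn}^2\bigl(\frac{x}{2g};k\bigr)},$$ where $\eta_3=\eta_3(L,\omega,c)$ satisfies $\alpha_0<\eta_3<\Phi_{\omega,c}^2(0)$ and, with $$\eta_1=\frac{-\eta_3+4c-\sqrt{A(\eta_3)}}2,\qquad \eta_2=\frac{-\eta_3+4c+\sqrt{A(\eta_3)}}2,$$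 one has $\eta_1<0<\eta_2<\eta_3$ and $$k=\sqrt{\frac{-\eta_1(\eta_3-\eta_2)}{\eta_3(\eta_2-\eta_1)}}\in(0,1),\qquad g=\frac{2}{\sqrt{\eta_3(\eta_2-\eta_1)}}>0,\qquad \beta=\sqrt{\frac{-\eta_3k^2}{\eta_1}}>0,\qquad 2L=4g\,K(k).$$ Moreover, in both cases $\omega>c^2/4$ and $\omega=c^2/4$, $c>0$, for every $x\in\mathbb{R}$ one has $\Phi^L_{\omega,c}(x)\to\Phi_{\omega,c}(x)$ as $L\to\infty$. -/

import Mathlib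

open Filter Topology

noncomputable section

namespace DNLS

/-! ### Jacobi elliptic functions (real argument, modulus `k`, `0 < k < 1`) -/

/-- Incomplete elliptic integral of the first kind,
`F(φ, k) = ∫₀^φ dθ / √(1 - k² sin² θ)`. -/
def ellipticF (k φ : ℝ) : ℝ :=
  ∫ θ in (0 : ℝ)..φ, 1 / Real.sqrt (1 - k ^ 2 * Real.sin θ ^ 2)

/-- Complete elliptic integral of the first kind, `K(k) = F(π/2, k)`. -/
def ellipticK (k : ℝ) : ℝ := ellipticF k (Real.pi / 2)

/-- For `0 ≤ k < 1` the map `φ ↦ F(φ, k)` is a bijection of `ℝ`, so that its inverse, used for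
the Jacobi elliptic functions below, is an honest inverse function. -/
theorem ellipticF_bijective {k : ℝ} (hk0 : 0 ≤ k) (hk1 : k < 1) :
    Function.Bijective (ellipticF k) := by
  have hpos : ∀ θ : ℝ, 0 < 1 - k ^ 2 * Real.sin θ ^ 2 := fun θ => by
    have h1 := Real.sin_sq_le_one θ
    nlinarith [sq_nonneg (Real.sin θ), sq_nonneg k]
  have hcont : Continuous fun θ : ℝ => 1 / Real.sqrt (1 - k ^ 2 * Real.sin θ ^ 2) :=
    continuous_const.div (by fun_prop) fun θ => (Real.sqrt_pos.2 (hpos θ)).ne'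
  have hone : ∀ θ : ℝ, 1 ≤ 1 / Real.sqrt (1 - k ^ 2 * Real.sin θ ^ 2) := fun θ => by
    rw [le_div_iff₀ (Real.sqrt_pos.2 (hpos θ)), one_mul, Real.sqrt_le_iff]
    refine ⟨zero_le_one, ?_⟩
    nlinarith [mul_nonneg (sq_nonneg k) (sq_nonneg (Real.sin θ))]
  have hsub : ∀ a b : ℝ, a ≤ b → b - a ≤ ellipticF k b - ellipticF k a := fun a b hab => by
    have h1 : ellipticF k b - ellipticF k a
        = ∫ θ in a..b, 1 / Real.sqrt (1 - k ^ 2 * Real.sin θ ^ 2) :=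
      intervalIntegral.integral_interval_sub_left
        (hcont.intervalIntegrable _ _) (hcont.intervalIntegrable _ _)
    have h2 : ∫ _ in a..b, (1 : ℝ) = b - a := by simp
    rw [h1, ← h2]
    exact intervalIntegral.integral_mono_on hab (by simp)
      (hcont.intervalIntegrable _ _) fun θ _ => hone θ
  have h0 : ellipticF k 0 = 0 := by simp [ellipticF]
  constructor
  · have : StrictMono (ellipticF k) := fun a b hab => by
      have := hsub a b hab.le
      linarith
    exact this.injective
  · have hc : Continuous (ellipticF k) :=
      intervalIntegral.continuous_primitive (fun _ _ => hcont.intervalIntegrable _ _) 0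
    refine hc.surjective ?_ ?_
    · refine tendsto_atTop_mono' _ ?_ tendsto_id
      filter_upwards [eventually_ge_atTop 0] with x hx
      have := hsub 0 x hx
      simp only [id]
      linarith
    · refine tendsto_atBot_mono' _ ?_ tendsto_id
      filter_upwards [eventually_le_atBot 0] with x hx
      have := hsub x 0 hx
      simp only [id]
      linarith

/-- Jacobi amplitude: the inverse function of `φ ↦ F(φ, k)`. -/
def jacobiAm (k : ℝ) : ℝ → ℝ := Function.invFun (ellipticF k)

/-- `sn(u; k) = sin φ`, where `u = F(φ, k)`. -/
def jacobiSn (u k : ℝ) : ℝ := Real.sin (jacobiAm k u)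

/-- `dn(u; k) = √(1 - k² sn²(u; k))`. -/
def jacobiDn (u k : ℝ) : ℝ := Real.sqrt (1 - k ^ 2 * jacobiSn u k ^ 2)

/-! ### Parameters and solitons -/

/-- The admissible parameters: `ω > c²/4`, or `ω = c²/4` and `c > 0`. -/
def Admissible (ω c : ℝ) : Prop := c ^ 2 / 4 < ω ∨ (ω = c ^ 2 / 4 ∧ 0 < c)

open Classical in
/-- The positive soliton profile `Φ_{ω,c}` on the whole line, the positive square root of its
explicit square; the second branch is the massless case `ω = c²/4`, `c > 0`. -/
def soliton (ω c x : ℝ) : ℝ :=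
  if c ^ 2 / 4 < ω then
    Real.sqrt ((4 * ω - c ^ 2) /
      (Real.sqrt ω *
        (Real.cosh (Real.sqrt (4 * ω - c ^ 2) * x) - c / (2 * Real.sqrt ω))))
  else
    Real.sqrt (4 * c / ((c * x) ^ 2 + 1))

/-- `α₀ = (4c + √(48ω + 4c²)) / 3`. -/
def alpha0 (ω c : ℝ) : ℝ := (4 * c + Real.sqrt (48 * ω + 4 * c ^ 2)) / 3

/-- `A(x) = -3x² + 8cx + 64ω`. -/
def polyA (ω c x : ℝ) : ℝ := -3 * x ^ 2 + 8 * c * x + 64 * ω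

/-- The threshold half-period `L₀ = 2π / √(α₀ √A(α₀))`. -/
def L0 (ω c : ℝ) : ℝ :=
  2 * Real.pi / Real.sqrt (alpha0 ω c * Real.sqrt (polyA ω c (alpha0 ω c)))

/-- `η₁ = (-η₃ + 4c - √A(η₃)) / 2`. -/
def eta1 (ω c η₃ : ℝ) : ℝ := (-η₃ + 4 * c - Real.sqrt (polyA ω c η₃)) / 2

/-- `η₂ = (-η₃ + 4c + √A(η₃)) / 2`. -/
def eta2 (ω c η₃ : ℝ) : ℝ := (-η₃ + 4 * c + Real.sqrt (polyA ω c η₃)) / 2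

/-- The modulus `k`, where `k² = -η₁(η₃ - η₂) / (η₃(η₂ - η₁))`. -/
def modulus (ω c η₃ : ℝ) : ℝ :=
  Real.sqrt (-eta1 ω c η₃ * (η₃ - eta2 ω c η₃) / (η₃ * (eta2 ω c η₃ - eta1 ω c η₃)))

/-- `g = 2 / √(η₃(η₂ - η₁))`. -/
def gParam (ω c η₃ : ℝ) : ℝ := 2 / Real.sqrt (η₃ * (eta2 ω c η₃ - eta1 ω c η₃))

/-- `β`, where `β² = -η₃ k² / η₁`. -/
def betaParam (ω c η₃ : ℝ) : ℝ := Real.sqrt (-η₃ * modulus ω c η₃ ^ 2 / eta1 ω c η₃)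

/-! ### Solutions of the stationary equation on the torus `ℝ / 2Lℤ` -/

/-- `Φ` is a classical solution on `ℝ / 2Lℤ` (a `2L`-periodic `C²` function on `ℝ`) of
`-Φ'' + (ω - c²/4) Φ + (c/2) |Φ|² Φ - (3/16) |Φ|⁴ Φ = 0`. -/
structure IsPeriodicSolution (ω c L : ℝ) (Φ : ℝ → ℝ) : Prop where
  periodic : Function.Periodic Φ (2 * L)
  contDiff : ContDiff ℝ 2 Φ
  equation : ∀ x, -deriv (deriv Φ) x + (ω - c ^ 2 / 4) * Φ x
    + c / 2 * |Φ x| ^ 2 * Φ x - 3 / 16 * |Φ x| ^ 4 * Φ x = 0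

/-- A function on `ℝ / 2Lℤ` has a single bump: starting from a peak `a` it strictly decreases to
a trough `b` and then strictly increases back to the peak `a + 2L`. -/
def IsSingleBump (L : ℝ) (Φ : ℝ → ℝ) : Prop :=
  ∃ a b : ℝ, a < b ∧ b < a + 2 * L ∧
    StrictAntiOn Φ (Set.Icc a b) ∧ StrictMonoOn Φ (Set.Icc b (a + 2 * L))

/-- `Φ` is a positive single-bump solution of the stationary equation on `ℝ / 2Lℤ`. -/
structure IsPositiveSingleBumpSolution (ω c L : ℝ) (Φ : ℝ → ℝ) : Prop where
  solution : IsPeriodicSolution ω c L Φ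
  pos : ∀ x, 0 < Φ x
  singleBump : IsSingleBump L Φ

end DNLS

end

/-! If `Φ` solves (ELL), then `φ = Φ²` satisfies `(φ')² = -φ(φ - η₁)(φ - η₂)(φ - η₃)/4`. Comparing
coefficients, the roots obey `η₁ + η₂ + η₃ = 4c` and have pairwise sum `-4(4ω - c²)`. A positive
single-bump solution is an oscillation of `φ` between `η₂` and `η₃` with `η₁ < 0`. The largest root
parametrizes these triples and ranges over the interval from `α₀`, where `η₂ = η₃`, to `2c + 4√ω`,
the squared height of the soliton, where `η₂ = 0`. For each such `η₃` the dnoidal formula is a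
Möbius function of `sn²`, and `solvesSystem_dnoidal` verifies the equation.

The core is that the half-period `2gK(k)` increases strictly from `L₀` to infinity on this interval.
In Gauss's form it is `4 ∫ dθ/√(p cos²θ + q sin²θ)` with `p = η₃(η₂ - η₁)` and `q = η₂(η₃ - η₁)`.
The argument `p` alone need not be monotone in `η₃`, but one arithmetic-geometric mean step
(`gaussIntegral_agm`) replaces `√p, √q` by quantities depending only on `p + q` and `pq`. By Vieta
both are increasing functions of `-η₁`, which decreases in `η₃` (`halfPeriod_strictMonoOn`).
Divergence at the upper end is logarithmic (`log_le_gaussIntegral`). Hence each `L > L₀` determines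
exactly one `η₃`.

For uniqueness, the conserved energy at a peak and a trough produces an admissible triple of roots,
and uniqueness for the initial value problem at the peak identifies the solution with a dnoidal one;
two single-bump periods of one function must agree (`le_of_bumps`).

For the limit, dnoidal profile and soliton solve the same equation with zero slope at the origin,
and their heights converge. Continuous dependence on initial values then gives convergence for `ω >
c²/4` and `ω = c²/4` alike, without degenerating elliptic functions. -/

noncomputable section

namespace DNLS

open Real Set intervalIntegral

/-! ### Complete elliptic integrals in Gauss's normalization -/

/-- Gauss's form `∫₀^{π/2} dθ / √(p cos² θ + q sin² θ)` of the complete elliptic integral. -/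
def gaussIntegral (p q : ℝ) : ℝ :=
  ∫ θ in (0 : ℝ)..(π / 2), 1 / √(p * cos θ ^ 2 + q * sin θ ^ 2)

theorem gaussForm_pos {p q : ℝ} (hp : 0 < p) (hq : 0 < q) (θ : ℝ) :
    0 < p * cos θ ^ 2 + q * sin θ ^ 2 := by
  rcases eq_or_ne (sin θ) 0 with h | h
  · have := sin_sq_add_cos_sq θ
    rw [h] at this ⊢
    nlinarith
  · have : 0 < sin θ ^ 2 := by positivity
    positivity

theorem continuous_gaussIntegrand {p q : ℝ} (hp : 0 < p) (hq : 0 < q) :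
    Continuous fun θ : ℝ => 1 / √(p * cos θ ^ 2 + q * sin θ ^ 2) :=
  continuous_const.div (by fun_prop) fun θ => (Real.sqrt_pos.2 (gaussForm_pos hp hq θ)).ne'

theorem integral_zero_pi_eq_two_mul {f : ℝ → ℝ} (hf : Continuous f)
    (hsymm : ∀ θ, f (π - θ) = f θ) :
    ∫ θ in (0 : ℝ)..π, f θ = 2 * ∫ θ in (0 : ℝ)..(π / 2), f θ := by
  have h1 : ∫ θ in (π / 2)..π, f θ = ∫ θ in (0 : ℝ)..(π / 2), f θ := by
    have h := integral_comp_sub_left (a := 0) (b := π / 2) f π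
    simp only [hsymm, sub_zero] at h
    rw [h]
    congr 1
    ring
  rw [← integral_add_adjacent_intervals (hf.intervalIntegrable 0 (π / 2))
    (hf.intervalIntegrable (π / 2) π), h1]
  ring

/-- The substitution `φ ↦ 2φ - arctan ((a - b) sin φ cos φ / (a cos² φ + b sin² φ))` underlying
the Landen transformation. -/
def landenMap (a b φ : ℝ) : ℝ :=
  2 * φ - arctan ((a - b) * (sin φ * cos φ) / (a * cos φ ^ 2 + b * sin φ ^ 2))

/-- Lagrange's identity for the vectors `(a cos φ, b sin φ)` and `(cos φ, sin φ)`, the second of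
which has length one. -/
theorem one_add_sq_landen {a b : ℝ} (ha : 0 < a) (hb : 0 < b) (φ : ℝ) :
    1 + ((a - b) * (sin φ * cos φ) / (a * cos φ ^ 2 + b * sin φ ^ 2)) ^ 2 =
      (a ^ 2 * cos φ ^ 2 + b ^ 2 * sin φ ^ 2) / (a * cos φ ^ 2 + b * sin φ ^ 2) ^ 2 := by
  have hW := (gaussForm_pos ha hb φ).ne'
  have hs : cos φ ^ 2 = 1 - sin φ ^ 2 := by linarith [sin_sq_add_cos_sq φ]
  rw [div_pow, eq_div_iff (pow_ne_zero 2 hW), add_mul, div_mul_cancel₀ _ (pow_ne_zero 2 hW),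
    mul_pow, mul_pow, hs]
  ring

theorem hasDerivAt_landenMap {a b : ℝ} (ha : 0 < a) (hb : 0 < b) (φ : ℝ) :
    HasDerivAt (landenMap a b)
      ((a + b) * (a * cos φ ^ 2 + b * sin φ ^ 2) / (a ^ 2 * cos φ ^ 2 + b ^ 2 * sin φ ^ 2)) φ := by
  have hW := (gaussForm_pos ha hb φ).ne'
  have hD := (gaussForm_pos (pow_pos ha 2) (pow_pos hb 2) φ).ne'
  have hs : cos φ ^ 2 = 1 - sin φ ^ 2 := by linarith [sin_sq_add_cos_sq φ]
  have h1 : HasDerivAt (fun φ => (a - b) * (sin φ * cos φ))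
      ((a - b) * (cos φ * cos φ + sin φ * -sin φ)) φ :=
    ((hasDerivAt_sin φ).mul (hasDerivAt_cos φ)).const_mul _
  have h2 : HasDerivAt (fun φ => a * cos φ ^ 2 + b * sin φ ^ 2)
      (a * (2 * cos φ * -sin φ) + b * (2 * sin φ * cos φ)) φ := by
    refine (((hasDerivAt_cos φ).pow 2).const_mul a |>.add
      (((hasDerivAt_sin φ).pow 2).const_mul b)).congr_deriv ?_
    simp
  refine (((hasDerivAt_id φ).const_mul 2).sub (h1.div h2 hW).arctan).congr_deriv ?_
  simp only [Pi.div_apply]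
  rw [one_add_sq_landen ha hb φ]
  field_simp
  have hs4 : cos φ ^ 4 = (1 - sin φ ^ 2) ^ 2 := by rw [← hs]; ring
  ring_nf
  rw [hs4, hs]
  ring

theorem landenMap_zero (a b : ℝ) : landenMap a b 0 = 0 := by simp [landenMap]

theorem landenMap_pi_div_two (a b : ℝ) : landenMap a b (π / 2) = π := by
  simp [landenMap]; ring

theorem sin_landenMap_sq {a b : ℝ} (ha : 0 < a) (hb : 0 < b) (φ : ℝ) :
    sin (landenMap a b φ) ^ 2 =
      (a + b) ^ 2 * (sin φ ^ 2 * cos φ ^ 2) / (a ^ 2 * cos φ ^ 2 + b ^ 2 * sin φ ^ 2) := by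
  have hW := (gaussForm_pos ha hb φ).ne'
  have hD := (gaussForm_pos (pow_pos ha 2) (pow_pos hb 2) φ).ne'
  have hs : cos φ ^ 2 = 1 - sin φ ^ 2 := by linarith [sin_sq_add_cos_sq φ]
  have hq := one_add_sq_landen ha hb φ
  set q := (a - b) * (sin φ * cos φ) / (a * cos φ ^ 2 + b * sin φ ^ 2) with hqdef
  have hq0 : 0 < 1 + q ^ 2 := by positivity
  have h1 : sin (landenMap a b φ) ^ 2 = (sin (2 * φ) - cos (2 * φ) * q) ^ 2 / (1 + q ^ 2) := by
    rw [landenMap, ← hqdef, sin_sub, sin_arctan, cos_arctan, mul_one_div, mul_div_assoc',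
      ← sub_div, div_pow, Real.sq_sqrt hq0.le]
  have h2 : sin (2 * φ) - cos (2 * φ) * q =
      (a + b) * (sin φ * cos φ) / (a * cos φ ^ 2 + b * sin φ ^ 2) := by
    rw [hqdef, sin_two_mul, cos_two_mul, eq_div_iff hW, sub_mul, mul_assoc (2 * cos φ ^ 2 - 1),
      div_mul_cancel₀ _ hW, hs]
    ring
  rw [h1, h2, hq]
  field_simp

/-- The new quadratic form pulls back to a perfect square over the old one. Its root is therefore
explicit and cancels against the derivative of the substitution. -/
theorem gaussForm_landenMap {a b : ℝ} (ha : 0 < a) (hb : 0 < b) (φ : ℝ) :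
    ((a + b) / 2) ^ 2 * cos (landenMap a b φ) ^ 2 + a * b * sin (landenMap a b φ) ^ 2 =
      ((a + b) * (a * cos φ ^ 2 + b * sin φ ^ 2) / 2) ^ 2 /
        (a ^ 2 * cos φ ^ 2 + b ^ 2 * sin φ ^ 2) := by
  have hD := (gaussForm_pos (pow_pos ha 2) (pow_pos hb 2) φ).ne'
  have hs : cos φ ^ 2 = 1 - sin φ ^ 2 := by linarith [sin_sq_add_cos_sq φ]
  have h : cos (landenMap a b φ) ^ 2 = 1 - sin (landenMap a b φ) ^ 2 := by
    linarith [sin_sq_add_cos_sq (landenMap a b φ)]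
  rw [h, sin_landenMap_sq ha hb]
  rw [hs] at hD ⊢
  field_simp
  ring

/-- Gauss's invariance of the complete elliptic integral under the arithmetic-geometric mean. -/
theorem gaussIntegral_agm {a b : ℝ} (ha : 0 < a) (hb : 0 < b) :
    gaussIntegral (a ^ 2) (b ^ 2) = gaussIntegral (((a + b) / 2) ^ 2) (a * b) := by
  have hA : 0 < ((a + b) / 2) ^ 2 := by positivity
  have hB : 0 < a * b := by positivity
  have hcont := continuous_gaussIntegrand hA hB
  have hW := fun φ => gaussForm_pos ha hb φ
  have hD := fun φ => gaussForm_pos (pow_pos ha 2) (pow_pos hb 2) φ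
  have hsub := integral_comp_mul_deriv (a := 0) (b := π / 2)
    (fun φ _ => hasDerivAt_landenMap ha hb φ)
    (Continuous.continuousOn (Continuous.div (by fun_prop) (by fun_prop) fun φ => (hD φ).ne'))
    hcont
  -- The substitution takes the endpoints `0, π/2` to `0, π`. The resulting factor two matches the
  -- factor two left by the derivative in `hpt`.
  rw [landenMap_zero, landenMap_pi_div_two,
    integral_zero_pi_eq_two_mul hcont (by simp [sin_pi_sub, cos_pi_sub])] at hsub
  have hpt : ∀ φ : ℝ, ((fun θ : ℝ => 1 / √(((a + b) / 2) ^ 2 * cos θ ^ 2 + a * b * sin θ ^ 2)) ∘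
      landenMap a b) φ * ((a + b) * (a * cos φ ^ 2 + b * sin φ ^ 2) /
        (a ^ 2 * cos φ ^ 2 + b ^ 2 * sin φ ^ 2)) =
      2 * (1 / √(a ^ 2 * cos φ ^ 2 + b ^ 2 * sin φ ^ 2)) := fun φ => by
    have hw := hW φ
    have hd := hD φ
    simp only [Function.comp_apply]
    rw [gaussForm_landenMap ha hb, Real.sqrt_div' _ hd.le, Real.sqrt_sq (by positivity)]
    have hr := Real.sqrt_pos.2 hd
    nth_rewrite 2 [← Real.sq_sqrt hd.le]
    field_simp
  simp only [hpt, integral_const_mul] at hsub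
  unfold gaussIntegral
  linarith

/-! ### Comparison, continuity and growth of the Gauss integral -/

theorem gaussIntegral_lt {p q p' q' : ℝ} (hp : 0 < p) (hq : 0 < q) (hpp : p < p') (hqq : q < q') :
    gaussIntegral p' q' < gaussIntegral p q := by
  have h : ∀ θ : ℝ, 1 / √(p' * cos θ ^ 2 + q' * sin θ ^ 2) <
      1 / √(p * cos θ ^ 2 + q * sin θ ^ 2) := fun θ => by
    have := gaussForm_pos (sub_pos.2 hpp) (sub_pos.2 hqq) θ
    exact one_div_lt_one_div_of_lt (Real.sqrt_pos.2 (gaussForm_pos hp hq θ))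
      (Real.sqrt_lt_sqrt (gaussForm_pos hp hq θ).le (by linarith))
  exact integral_lt_integral_of_continuousOn_of_le_of_exists_lt (by positivity)
    (continuous_gaussIntegrand (hp.trans hpp) (hq.trans hqq)).continuousOn
    (continuous_gaussIntegrand hp hq).continuousOn (fun θ _ => (h θ).le)
    ⟨0, ⟨le_rfl, by positivity⟩, h 0⟩

theorem continuousOn_gaussIntegral :
    ContinuousOn (fun r : ℝ × ℝ => gaussIntegral r.1 r.2) {r | 0 < r.1 ∧ 0 < r.2} := by
  rw [continuousOn_iff_continuous_domRestrict]
  refine continuous_parametric_intervalIntegral_of_continuous'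
    (f := fun (r : {r : ℝ × ℝ | 0 < r.1 ∧ 0 < r.2}) θ =>
      1 / √(r.1.1 * cos θ ^ 2 + r.1.2 * sin θ ^ 2)) ?_ 0 (π / 2)
  refine continuous_const.div (by fun_prop) fun z => ?_
  exact (Real.sqrt_pos.2 (gaussForm_pos z.1.2.1 z.1.2.2 z.2)).ne'

theorem gaussIntegral_self {p : ℝ} : gaussIntegral p p = π / 2 / √p := by
  have : ∀ θ : ℝ, p * cos θ ^ 2 + p * sin θ ^ 2 = p := fun θ => by
    rw [← mul_add, cos_sq_add_sin_sq, mul_one]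
  simp only [gaussIntegral, this, integral_const, sub_zero, smul_eq_mul]
  ring

/-- The reflection `θ ↦ π/2 - θ` moves the peak of the integrand for small `b` to `t = 0`. There `a²
sin² t + b² cos² t ≤ (at + b)²`, and `1/(at + b)` integrates to a logarithm. -/
theorem log_le_gaussIntegral {a b : ℝ} (ha : 0 < a) (hb : 0 < b) :
    log (1 + a * (π / 2) / b) / a ≤ gaussIntegral (a ^ 2) (b ^ 2) := by
  have hpos : ∀ t : ℝ, t ∈ Icc 0 (π / 2) → 0 < a * t + b := fun t ht => by
    have := mul_nonneg ha.le ht.1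
    linarith
  have hI : ∫ t in (0 : ℝ)..(π / 2), 1 / (a * t + b) = log (1 + a * (π / 2) / b) / a := by
    have hu : uIcc (0 : ℝ) (π / 2) = Icc 0 (π / 2) := uIcc_of_le (by positivity)
    rw [integral_eq_sub_of_hasDerivAt (f := fun t => log (a * t + b) / a)]
    · have h0 : 0 < a * (π / 2) + b := by positivity
      simp only [mul_zero, zero_add]
      rw [← sub_div, ← Real.log_div h0.ne' hb.ne']
      congr 2
      field_simp
      ring
    · intro t ht
      rw [hu] at ht
      have h1 : HasDerivAt (fun t => a * t + b) a t := by
        simpa using ((hasDerivAt_id t).const_mul a).add_const b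
      refine ((h1.log (hpos t ht).ne').div_const a).congr_deriv ?_
      field_simp
    · refine ContinuousOn.intervalIntegrable ?_
      rw [hu]
      exact continuousOn_const.div (by fun_prop) fun t ht => (hpos t ht).ne'
  have hJ : gaussIntegral (a ^ 2) (b ^ 2) =
      ∫ t in (0 : ℝ)..(π / 2), 1 / √(a ^ 2 * sin t ^ 2 + b ^ 2 * cos t ^ 2) := by
    have h := integral_comp_sub_left (a := 0) (b := π / 2)
      (fun θ => 1 / √(a ^ 2 * cos θ ^ 2 + b ^ 2 * sin θ ^ 2)) (π / 2)
    simp only [cos_pi_div_two_sub, sin_pi_div_two_sub, sub_self, sub_zero] at h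
    rw [h, gaussIntegral]
  rw [← hI, hJ]
  refine integral_mono_on (by positivity) ?_ ?_ fun t ht => ?_
  · refine ContinuousOn.intervalIntegrable ?_
    rw [uIcc_of_le (by positivity)]
    exact continuousOn_const.div (by fun_prop) fun t ht => (hpos t ht).ne'
  · have := continuous_gaussIntegrand (pow_pos hb 2) (pow_pos ha 2)
    simp only [add_comm (b ^ 2 * _)] at this
    exact this.intervalIntegrable _ _
  · have hd := gaussForm_pos (pow_pos hb 2) (pow_pos ha 2) t
    refine one_div_le_one_div_of_le (Real.sqrt_pos.2 (by linarith)) ?_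
    rw [Real.sqrt_le_left (hpos t ht).le]
    have h1 := Real.sin_le ht.1
    have h2 := Real.sin_nonneg_of_nonneg_of_le_pi ht.1 (by linarith [ht.2, pi_pos])
    have h3 : sin t ^ 2 ≤ t ^ 2 := by gcongr
    have h4 := cos_sq_le_one t
    have h5 : 0 ≤ a * t * b := mul_nonneg (mul_nonneg ha.le ht.1) hb.le
    have h6 := mul_le_mul_of_nonneg_left h3 (sq_nonneg a)
    have h7 := mul_le_mul_of_nonneg_left h4 (sq_nonneg b)
    nlinarith

/-! ### Jacobi elliptic functions -/

section Jacobi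

variable {k : ℝ}

theorem one_sub_mul_sin_sq_pos (hk0 : 0 ≤ k) (hk1 : k < 1) (θ : ℝ) :
    0 < 1 - k ^ 2 * sin θ ^ 2 := by
  have h1 := sin_sq_le_one θ
  nlinarith [sq_nonneg (sin θ), sq_nonneg k]

theorem continuous_ellipticIntegrand (hk0 : 0 ≤ k) (hk1 : k < 1) :
    Continuous fun θ : ℝ => 1 / √(1 - k ^ 2 * sin θ ^ 2) :=
  continuous_const.div (by fun_prop) fun θ =>
    (Real.sqrt_pos.2 (one_sub_mul_sin_sq_pos hk0 hk1 θ)).ne'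

theorem hasDerivAt_ellipticF (hk0 : 0 ≤ k) (hk1 : k < 1) (φ : ℝ) :
    HasDerivAt (ellipticF k) (1 / √(1 - k ^ 2 * sin φ ^ 2)) φ :=
  (continuous_ellipticIntegrand hk0 hk1).integral_hasStrictDerivAt 0 φ |>.hasDerivAt

theorem ellipticF_zero (k : ℝ) : ellipticF k 0 = 0 := by simp [ellipticF]

theorem strictMono_ellipticF (hk0 : 0 ≤ k) (hk1 : k < 1) : StrictMono (ellipticF k) :=
  strictMono_of_deriv_pos fun φ => by
    rw [(hasDerivAt_ellipticF hk0 hk1 φ).deriv]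
    have := one_sub_mul_sin_sq_pos hk0 hk1 φ
    positivity

theorem ellipticF_add_pi (hk0 : 0 ≤ k) (hk1 : k < 1) (φ : ℝ) :
    ellipticF k (φ + π) = ellipticF k φ + 2 * ellipticK k := by
  have hcont := continuous_ellipticIntegrand hk0 hk1
  have hper : Function.Periodic (fun θ : ℝ => 1 / √(1 - k ^ 2 * sin θ ^ 2)) π := fun θ => by
    simp [sin_add_pi]
  have h1 := hper.intervalIntegral_add_eq φ 0
  rw [zero_add, integral_zero_pi_eq_two_mul hcont (by simp [sin_pi_sub])] at h1
  rw [ellipticK, ellipticF, ellipticF, ellipticF, ← h1]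
  exact (integral_add_adjacent_intervals (hcont.intervalIntegrable _ _)
    (hcont.intervalIntegrable _ _)).symm

theorem ellipticF_jacobiAm (hk0 : 0 ≤ k) (hk1 : k < 1) (u : ℝ) :
    ellipticF k (jacobiAm k u) = u :=
  Function.rightInverse_invFun (ellipticF_bijective hk0 hk1).surjective u

theorem jacobiAm_ellipticF (hk0 : 0 ≤ k) (hk1 : k < 1) (φ : ℝ) :
    jacobiAm k (ellipticF k φ) = φ :=
  Function.leftInverse_invFun (ellipticF_bijective hk0 hk1).injective φ

theorem jacobiAm_zero (hk0 : 0 ≤ k) (hk1 : k < 1) : jacobiAm k 0 = 0 := by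
  simpa [ellipticF_zero] using jacobiAm_ellipticF hk0 hk1 0

theorem jacobiAm_ellipticK (hk0 : 0 ≤ k) (hk1 : k < 1) : jacobiAm k (ellipticK k) = π / 2 :=
  jacobiAm_ellipticF hk0 hk1 _

theorem jacobiAm_add_two_ellipticK (hk0 : 0 ≤ k) (hk1 : k < 1) (u : ℝ) :
    jacobiAm k (u + 2 * ellipticK k) = jacobiAm k u + π := by
  rw [← jacobiAm_ellipticF hk0 hk1 (jacobiAm k u + π), ellipticF_add_pi hk0 hk1,
    ellipticF_jacobiAm hk0 hk1]

theorem strictMono_jacobiAm (hk0 : 0 ≤ k) (hk1 : k < 1) : StrictMono (jacobiAm k) :=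
  fun u v huv => by
    rw [← (strictMono_ellipticF hk0 hk1).lt_iff_lt, ellipticF_jacobiAm hk0 hk1,
      ellipticF_jacobiAm hk0 hk1]
    exact huv

theorem continuous_jacobiAm (hk0 : 0 ≤ k) (hk1 : k < 1) : Continuous (jacobiAm k) :=
  (strictMono_jacobiAm hk0 hk1).monotone.continuous_of_surjective fun φ =>
    ⟨_, jacobiAm_ellipticF hk0 hk1 φ⟩

theorem jacobiDn_pos (hk0 : 0 ≤ k) (hk1 : k < 1) (u : ℝ) : 0 < jacobiDn u k :=
  Real.sqrt_pos.2 (one_sub_mul_sin_sq_pos hk0 hk1 _)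

theorem jacobiDn_sq (hk0 : 0 ≤ k) (hk1 : k < 1) (u : ℝ) :
    jacobiDn u k ^ 2 = 1 - k ^ 2 * jacobiSn u k ^ 2 :=
  Real.sq_sqrt (one_sub_mul_sin_sq_pos hk0 hk1 _).le

theorem hasDerivAt_jacobiAm (hk0 : 0 ≤ k) (hk1 : k < 1) (u : ℝ) :
    HasDerivAt (jacobiAm k) (jacobiDn u k) u := by
  have h := (hasDerivAt_ellipticF hk0 hk1 (jacobiAm k u)).of_local_left_inverse
    (continuous_jacobiAm hk0 hk1).continuousAt
    (one_div_pos.2 (jacobiDn_pos hk0 hk1 u)).ne'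
    (Eventually.of_forall fun v => ellipticF_jacobiAm hk0 hk1 v)
  refine h.congr_deriv ?_
  simp [jacobiDn, jacobiSn]

theorem hasDerivAt_jacobiSn (hk0 : 0 ≤ k) (hk1 : k < 1) (u : ℝ) :
    HasDerivAt (fun u => jacobiSn u k) (cos (jacobiAm k u) * jacobiDn u k) u :=
  (hasDerivAt_jacobiAm hk0 hk1 u).sin

theorem hasDerivAt_jacobiDn (hk0 : 0 ≤ k) (hk1 : k < 1) (u : ℝ) :
    HasDerivAt (fun u => jacobiDn u k) (-k ^ 2 * jacobiSn u k * cos (jacobiAm k u)) u := by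
  have hd := jacobiDn_pos hk0 hk1 u
  have hs := one_sub_mul_sin_sq_pos hk0 hk1 (jacobiAm k u)
  refine (((((hasDerivAt_jacobiSn hk0 hk1 u).pow 2).const_mul (k ^ 2)).const_sub 1).sqrt
    hs.ne').congr_deriv ?_
  change _ / (2 * jacobiDn u k) = _
  field_simp
  push_cast
  ring

theorem jacobiSn_sq_add_two_ellipticK (hk0 : 0 ≤ k) (hk1 : k < 1) (u : ℝ) :
    jacobiSn (u + 2 * ellipticK k) k ^ 2 = jacobiSn u k ^ 2 := by
  simp [jacobiSn, jacobiAm_add_two_ellipticK hk0 hk1, sin_add_pi]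

theorem jacobiSn_zero (hk0 : 0 ≤ k) (hk1 : k < 1) : jacobiSn 0 k = 0 := by
  simp [jacobiSn, jacobiAm_zero hk0 hk1]

theorem ellipticK_pos (hk0 : 0 ≤ k) (hk1 : k < 1) : 0 < ellipticK k := by
  rw [← ellipticF_zero k]
  exact strictMono_ellipticF hk0 hk1 (by positivity)

theorem strictMonoOn_jacobiSn_sq (hk0 : 0 ≤ k) (hk1 : k < 1) :
    StrictMonoOn (fun u => jacobiSn u k ^ 2) (Icc 0 (ellipticK k)) := by
  intro u hu v hv huv
  have hm := strictMono_jacobiAm hk0 hk1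
  have h0 : 0 ≤ jacobiAm k u := by
    rw [← jacobiAm_zero hk0 hk1]; exact hm.monotone hu.1
  have h1 : jacobiAm k v ≤ π / 2 := by
    rw [← jacobiAm_ellipticK hk0 hk1]; exact hm.monotone hv.2
  have h2 := hm huv
  have h3 : sin (jacobiAm k u) < sin (jacobiAm k v) :=
    sin_lt_sin_of_lt_of_le_pi_div_two (by linarith [pi_pos]) h1 h2
  exact pow_lt_pow_left₀ h3 (sin_nonneg_of_nonneg_of_le_pi h0 (by linarith [pi_pos])) two_ne_zero

theorem strictAntiOn_jacobiSn_sq (hk0 : 0 ≤ k) (hk1 : k < 1) :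
    StrictAntiOn (fun u => jacobiSn u k ^ 2) (Icc (ellipticK k) (2 * ellipticK k)) := by
  intro u hu v hv huv
  have hm := strictMono_jacobiAm hk0 hk1
  have h0 : π / 2 ≤ jacobiAm k u := by
    rw [← jacobiAm_ellipticK hk0 hk1]; exact hm.monotone hu.1
  have h1 : jacobiAm k v ≤ π := by
    have h := jacobiAm_add_two_ellipticK hk0 hk1 0
    rw [zero_add, jacobiAm_zero hk0 hk1, zero_add] at h
    rw [← h]; exact hm.monotone hv.2
  have h2 := hm huv
  have h3 : sin (π - jacobiAm k v) < sin (π - jacobiAm k u) :=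
    sin_lt_sin_of_lt_of_le_pi_div_two (by linarith [pi_pos]) (by linarith) (by linarith)
  rw [sin_pi_sub, sin_pi_sub] at h3
  exact pow_lt_pow_left₀ h3 (sin_nonneg_of_nonneg_of_le_pi (by linarith [pi_pos]) h1) two_ne_zero

/-- Reduction of `K(k)` to Gauss's form. -/
theorem ellipticK_div_sqrt {p q : ℝ} (hp : 0 < p) (hk : p * (1 - k ^ 2) = q) :
    ellipticK k / √p = gaussIntegral p q := by
  rw [ellipticK, ellipticF, gaussIntegral, ← integral_div]
  congr 1
  ext θ
  rw [div_div, ← Real.sqrt_mul' _ hp.le, ← hk]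
  congr 2
  linear_combination -p * (sin_sq_add_cos_sq θ)

end Jacobi

/-! ### The roots of the first integral -/

/-- The maximum `2c + 4√ω` of the squared soliton. -/
def solitonPeak (ω c : ℝ) : ℝ := 2 * c + 4 * √ω

section Roots

variable {ω c x : ℝ}

theorem Admissible.le (h : Admissible ω c) : c ^ 2 / 4 ≤ ω :=
  h.elim le_of_lt fun h => h.1.ge

theorem Admissible.omega_pos (h : Admissible ω c) : 0 < ω := by
  rcases h with h | ⟨h, hc⟩
  · linarith [sq_nonneg c]
  · rw [h]; positivity

theorem Admissible.le_two_sqrt (h : Admissible ω c) : c ≤ 2 * √ω := by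
  have h1 := h.le
  have h2 := Real.sq_sqrt h.omega_pos.le
  exact (abs_le_of_sq_le_sq' (by linarith : c ^ 2 ≤ (2 * √ω) ^ 2) (by positivity)).2

theorem Admissible.neg_two_sqrt_lt (h : Admissible ω c) : -(2 * √ω) < c := by
  have h2 := Real.sq_sqrt h.omega_pos.le
  have h3 := Real.sqrt_pos.2 h.omega_pos
  rcases h with h | ⟨-, hc⟩
  · exact (abs_lt_of_sq_lt_sq' (by linarith : c ^ 2 < (2 * √ω) ^ 2) (by positivity)).1
  · linarith

theorem three_mul_alpha0 (ω c : ℝ) : 3 * alpha0 ω c - 4 * c = √(48 * ω + 4 * c ^ 2) := by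
  rw [alpha0]; ring

theorem Admissible.radicand_pos (h : Admissible ω c) : 0 < 48 * ω + 4 * c ^ 2 := by
  have := h.omega_pos
  positivity

/-- The polynomial `3x² - 8cx - 4(4ω - c²)` equals `(x - η₁)(x - η₂)` when `x = η₃`, so its larger
zero `α₀` is where the two upper roots collide. -/
theorem alpha0_quadratic (h : Admissible ω c) :
    3 * alpha0 ω c ^ 2 = 8 * c * alpha0 ω c + 4 * (4 * ω - c ^ 2) := by
  have h1 := Real.sq_sqrt h.radicand_pos.le
  rw [← three_mul_alpha0] at h1
  linear_combination h1 / 3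

theorem alpha0_pos (h : Admissible ω c) : 0 < alpha0 ω c := by
  have h1 : |4 * c| < √(48 * ω + 4 * c ^ 2) ∨ 0 < c := by
    rcases h with h' | ⟨-, hc⟩
    · left
      rw [← Real.sqrt_sq_eq_abs]
      exact Real.sqrt_lt_sqrt (sq_nonneg _) (by linarith)
    · exact Or.inr hc
  have h2 := Real.sqrt_pos.2 h.radicand_pos
  rw [alpha0]
  rcases h1 with h1 | h1
  · have := neg_abs_le (4 * c)
    linarith
  · linarith

theorem alpha0_lt_solitonPeak (h : Admissible ω c) : alpha0 ω c < solitonPeak ω c := by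
  have h1 := h.neg_two_sqrt_lt
  have h2 := Real.sqrt_pos.2 h.omega_pos
  have h3 := Real.sq_sqrt h.omega_pos.le
  have h4 : √(48 * ω + 4 * c ^ 2) < 2 * c + 12 * √ω := by
    rw [Real.sqrt_lt' (by linarith)]
    nlinarith
  rw [alpha0, solitonPeak]
  linarith

theorem soliton_zero_sq (h : Admissible ω c) : soliton ω c 0 ^ 2 = solitonPeak ω c := by
  have h2 := Real.sqrt_pos.2 h.omega_pos
  have h3 := Real.sq_sqrt h.omega_pos.le
  have h4 := h.neg_two_sqrt_lt
  rw [soliton, solitonPeak]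
  split_ifs with hc
  · have h5 : c < 2 * √ω :=
      (abs_lt_of_sq_lt_sq' (by linarith : c ^ 2 < (2 * √ω) ^ 2) (by positivity)).2
    have h6 : √ω * (1 - c / (2 * √ω)) = (2 * √ω - c) / 2 := by field_simp
    have h7 : 4 * ω - c ^ 2 = (2 * √ω - c) * (2 * √ω + c) := by linear_combination -4 * h3
    have h8 : 2 * √ω - c ≠ 0 := by linarith
    rw [mul_zero, cosh_zero, h6, h7, Real.sq_sqrt]
    · field_simp
      ring
    · exact div_nonneg (mul_nonneg (by linarith) (by linarith)) (by linarith)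
  · obtain ⟨hω, hc⟩ := h.resolve_left hc
    have h5 : √ω = c / 2 := by
      rw [hω, show c ^ 2 / 4 = (c / 2) ^ 2 by ring, Real.sqrt_sq (by positivity)]
    rw [h5, mul_zero, Real.sq_sqrt (by positivity)]
    ring

/-! ### Vieta relations, signs and ordering of the roots -/

theorem eta1_add_eta2 (ω c x : ℝ) : eta1 ω c x + eta2 ω c x = 4 * c - x := by
  rw [eta1, eta2]; ring

theorem eta2_sub_eta1 (ω c x : ℝ) : eta2 ω c x - eta1 ω c x = √(polyA ω c x) := by
  rw [eta1, eta2]; ring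

/-- The difference of the two sides is `4(2c + 4√ω - x)(x - (2c - 4√ω))`, and `2c - 4√ω ≤ 0`. It is
also `-4η₁η₂`, so this is the statement that the two roots have opposite signs. -/
theorem sq_lt_polyA (h : Admissible ω c) (h0 : 0 < x) (hx : x < solitonPeak ω c) :
    (4 * c - x) ^ 2 < polyA ω c x := by
  have h3 := Real.sq_sqrt h.omega_pos.le
  have h1 := h.le_two_sqrt
  rw [solitonPeak] at hx
  have h4 : 0 < (2 * c + 4 * √ω - x) * (x - (2 * c - 4 * √ω)) :=
    mul_pos (by linarith) (by linarith)
  rw [polyA]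
  nlinarith

theorem polyA_pos (h : Admissible ω c) (h0 : 0 < x) (hx : x < solitonPeak ω c) :
    0 < polyA ω c x :=
  (sq_nonneg _).trans_lt (sq_lt_polyA h h0 hx)

theorem abs_lt_sqrt_polyA (h : Admissible ω c) (h0 : 0 < x) (hx : x < solitonPeak ω c) :
    |4 * c - x| < √(polyA ω c x) :=
  (Real.lt_sqrt (abs_nonneg _)).2 (by rw [sq_abs]; exact sq_lt_polyA h h0 hx)

theorem eta1_neg (h : Admissible ω c) (h0 : 0 < x) (hx : x < solitonPeak ω c) :
    eta1 ω c x < 0 := by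
  have := abs_lt_sqrt_polyA h h0 hx
  have := le_abs_self (4 * c - x)
  rw [eta1]; linarith

theorem eta2_pos (h : Admissible ω c) (h0 : 0 < x) (hx : x < solitonPeak ω c) :
    0 < eta2 ω c x := by
  have := abs_lt_sqrt_polyA h h0 hx
  have := neg_abs_le (4 * c - x)
  rw [eta2]; linarith

theorem eta_pair_sum (h : Admissible ω c) (h0 : 0 < x) (hx : x < solitonPeak ω c) :
    eta1 ω c x * eta2 ω c x + x * (eta1 ω c x + eta2 ω c x) = -4 * (4 * ω - c ^ 2) := by
  have h1 := Real.sq_sqrt (polyA_pos h h0 hx).le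
  rw [eta1_add_eta2, eta1, eta2]
  have h2 : polyA ω c x = -3 * x ^ 2 + 8 * c * x + 64 * ω := rfl
  linear_combination -h1 / 4 - h2 / 4

/-- The difference of the two sides is four times the quadratic of `alpha0_quadratic`, which is
positive beyond its larger zero. It encodes `η₂ < η₃`. -/
theorem polyA_lt_sq (h : Admissible ω c) (hx : alpha0 ω c < x) :
    polyA ω c x < (3 * x - 4 * c) ^ 2 := by
  have h1 := alpha0_quadratic h
  have h2 := alpha0_pos h
  have h3 := three_mul_alpha0 ω c
  have h4 := Real.sqrt_nonneg (48 * ω + 4 * c ^ 2)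
  rw [polyA]
  nlinarith [mul_pos (sub_pos.2 hx) (by linarith : 0 < 3 * (x + alpha0 ω c) - 8 * c + alpha0 ω c)]

theorem polyA_alpha0 (h : Admissible ω c) :
    polyA ω c (alpha0 ω c) = (3 * alpha0 ω c - 4 * c) ^ 2 := by
  rw [polyA]
  linear_combination -4 * alpha0_quadratic h

theorem sqrt_polyA_lt (h : Admissible ω c) (hx : alpha0 ω c < x) :
    √(polyA ω c x) < 3 * x - 4 * c := by
  have h3 := three_mul_alpha0 ω c
  have h4 := Real.sqrt_nonneg (48 * ω + 4 * c ^ 2)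
  rw [Real.sqrt_lt' (by linarith)]
  exact polyA_lt_sq h hx

theorem sqrt_polyA_alpha0 (h : Admissible ω c) :
    √(polyA ω c (alpha0 ω c)) = 3 * alpha0 ω c - 4 * c := by
  rw [polyA_alpha0 h, Real.sqrt_sq]
  rw [three_mul_alpha0]
  positivity

theorem eta2_lt (h : Admissible ω c) (hx : alpha0 ω c < x) : eta2 ω c x < x := by
  have := sqrt_polyA_lt h hx
  rw [eta2]; linarith

theorem eta2_alpha0 (h : Admissible ω c) : eta2 ω c (alpha0 ω c) = alpha0 ω c := by
  rw [eta2, sqrt_polyA_alpha0 h]; ring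

theorem eta2_le (h : Admissible ω c) (hx : alpha0 ω c ≤ x) : eta2 ω c x ≤ x :=
  hx.eq_or_lt.elim (fun hx => by rw [← hx, eta2_alpha0 h]) fun hx => (eta2_lt h hx).le

theorem eta2_solitonPeak (h : Admissible ω c) : eta2 ω c (solitonPeak ω c) = 0 := by
  have h3 := Real.sq_sqrt h.omega_pos.le
  have h1 : polyA ω c (solitonPeak ω c) = (4 * √ω - 2 * c) ^ 2 := by
    rw [polyA, solitonPeak]
    linear_combination -64 * h3
  have := h.le_two_sqrt
  rw [eta2, h1, Real.sqrt_sq (by linarith), solitonPeak]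
  ring

/-- Since `η₁ = (4c - x - √A)/2`, the root `√A` has to fall faster than `x` grows. This follows from
`A(x) - A(y) = (y - x)(3(x + y) - 8c)` together with `√A(x) + √A(y) < 3(x + y) - 8c`, the sum of the
bounds expressing `η₂ ≤ η₃`. -/
theorem eta1_lt_eta1 (h : Admissible ω c) {y : ℝ} (hx : alpha0 ω c ≤ x) (hxy : x < y)
    (hy : y < solitonPeak ω c) : eta1 ω c x < eta1 ω c y := by
  have h0 := (alpha0_pos h).trans_le hx
  have h1 : √(polyA ω c x) ≤ 3 * x - 4 * c := by
    have := eta2_le h hx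
    rw [eta2] at this
    linarith
  have h2 := sqrt_polyA_lt h (hx.trans_lt hxy)
  have h3 := Real.sq_sqrt (polyA_pos h h0 (hxy.trans hy)).le
  have h4 := Real.sq_sqrt (polyA_pos h (h0.trans hxy) hy).le
  have h5 := Real.sqrt_pos.2 (polyA_pos h h0 (hxy.trans hy))
  have h6 := Real.sqrt_pos.2 (polyA_pos h (h0.trans hxy) hy)
  rw [eta1, eta1]
  set a := √(polyA ω c x)
  set b := √(polyA ω c y)
  have h7 : (a - b) * (a + b) = (y - x) * (3 * (x + y) - 8 * c) := by
    rw [polyA] at h3 h4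
    linear_combination h3 - h4
  have h8 : y - x < a - b := by
    by_contra! h9
    have h10 := mul_le_mul_of_nonneg_right h9 (by linarith : 0 ≤ a + b)
    have h11 := mul_lt_mul_of_pos_left (by linarith : a + b < 3 * (x + y) - 8 * c)
      (sub_pos.2 hxy)
    linarith
  linarith

/-- Vieta turns the two bounds into signs of products: `(3x₃ - 4c)² - (48ω + 4c²) = 3(x₃ - x₁)(x₃ -
x₂)` and `16ω - (x₃ - 2c)² = -x₁x₂`. It serves for roots read off from an arbitrary solution. -/
theorem mem_Ioo_of_roots (h : Admissible ω c) {x₁ x₂ x₃ : ℝ} (h1 : x₁ < 0) (h2 : 0 < x₂)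
    (h23 : x₂ < x₃) (hsum : x₁ + x₂ + x₃ = 4 * c)
    (hpair : x₁ * x₂ + x₁ * x₃ + x₂ * x₃ = -4 * (4 * ω - c ^ 2)) :
    x₃ ∈ Ioo (alpha0 ω c) (solitonPeak ω c) := by
  constructor
  · have h4 : √(48 * ω + 4 * c ^ 2) < 3 * x₃ - 4 * c := by
      rw [Real.sqrt_lt' (by linarith)]
      have h5 : (3 * x₃ - 4 * c) ^ 2 - (48 * ω + 4 * c ^ 2) = 3 * ((x₃ - x₁) * (x₃ - x₂)) := by
        linear_combination (6 * x₃) * hsum - 3 * hpair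
      have := mul_pos (by linarith : 0 < x₃ - x₁) (by linarith : 0 < x₃ - x₂)
      linarith
    rw [alpha0]
    linarith
  · have h4 : (x₃ - 2 * c) ^ 2 < (4 * √ω) ^ 2 := by
      have h3 := Real.sq_sqrt h.omega_pos.le
      have h5 : (4 * √ω) ^ 2 - (x₃ - 2 * c) ^ 2 = -(x₁ * x₂) := by
        linear_combination 16 * h3 - x₃ * hsum + hpair
      have := mul_pos (neg_pos.2 h1) h2
      linarith
    have := (abs_lt_of_sq_lt_sq' h4 (by positivity)).2
    rw [solitonPeak]
    linarith

/-! ### The half-period as a function of the largest root -/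

/-- The half-period `2gK(k)` of the solution whose square has maximum `η₃`. -/
def halfPeriod (ω c η₃ : ℝ) : ℝ := 2 * gParam ω c η₃ * ellipticK (modulus ω c η₃)

theorem gaussParam_pos (h : Admissible ω c) (hx : alpha0 ω c ≤ x) (hx' : x < solitonPeak ω c) :
    0 < x * (eta2 ω c x - eta1 ω c x) ∧ 0 < eta2 ω c x * (x - eta1 ω c x) := by
  have h0 := (alpha0_pos h).trans_le hx
  have h1 := eta1_neg h h0 hx'
  have h2 := eta2_pos h h0 hx'
  exact ⟨mul_pos h0 (by linarith), mul_pos h2 (by linarith)⟩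

theorem modulus_sq (h : Admissible ω c) (hx : alpha0 ω c ≤ x) (hx' : x < solitonPeak ω c) :
    modulus ω c x ^ 2 =
      -eta1 ω c x * (x - eta2 ω c x) / (x * (eta2 ω c x - eta1 ω c x)) := by
  rw [modulus, Real.sq_sqrt]
  have h0 := (alpha0_pos h).trans_le hx
  have h1 := eta1_neg h h0 hx'
  have h2 := eta2_le h hx
  exact div_nonneg (mul_nonneg (by linarith) (by linarith)) (gaussParam_pos h hx hx').1.le

theorem modulus_nonneg (ω c x : ℝ) : 0 ≤ modulus ω c x := Real.sqrt_nonneg _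

theorem modulus_lt_one (h : Admissible ω c) (hx : alpha0 ω c ≤ x) (hx' : x < solitonPeak ω c) :
    modulus ω c x < 1 := by
  obtain ⟨h1, h2⟩ := gaussParam_pos h hx hx'
  rw [modulus, Real.sqrt_lt' one_pos, div_lt_iff₀ h1]
  linarith

theorem modulus_pos (h : Admissible ω c) (hx : alpha0 ω c < x) (hx' : x < solitonPeak ω c) :
    0 < modulus ω c x := by
  have h0 := (alpha0_pos h).trans hx
  exact Real.sqrt_pos.2 (div_pos (mul_pos (neg_pos.2 (eta1_neg h h0 hx'))
    (sub_pos.2 (eta2_lt h hx))) (gaussParam_pos h hx.le hx').1)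

theorem gParam_pos (h : Admissible ω c) (hx : alpha0 ω c ≤ x) (hx' : x < solitonPeak ω c) :
    0 < gParam ω c x :=
  div_pos two_pos (Real.sqrt_pos.2 (gaussParam_pos h hx hx').1)

theorem betaParam_arg_pos (h : Admissible ω c) (hx : alpha0 ω c < x)
    (hx' : x < solitonPeak ω c) : 0 < -x * modulus ω c x ^ 2 / eta1 ω c x := by
  have h0 := (alpha0_pos h).trans hx
  have h1 := eta1_neg h h0 hx'
  have h2 := modulus_pos h hx hx'
  refine div_pos_of_neg_of_neg ?_ h1
  have : 0 < x * modulus ω c x ^ 2 := by positivity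
  linarith

theorem halfPeriod_eq (h : Admissible ω c) (hx : alpha0 ω c ≤ x) (hx' : x < solitonPeak ω c) :
    halfPeriod ω c x =
      4 * gaussIntegral (x * (eta2 ω c x - eta1 ω c x)) (eta2 ω c x * (x - eta1 ω c x)) := by
  obtain ⟨h1, h2⟩ := gaussParam_pos h hx hx'
  rw [halfPeriod, gParam, ← ellipticK_div_sqrt (k := modulus ω c x) h1]
  · ring
  · rw [modulus_sq h hx hx', mul_sub, mul_div_cancel₀ _ h1.ne']
    ring

theorem halfPeriod_eq_agm (h : Admissible ω c) (hx : alpha0 ω c ≤ x)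
    (hx' : x < solitonPeak ω c) :
    halfPeriod ω c x = 4 * gaussIntegral
      ((x * (eta2 ω c x - eta1 ω c x) + eta2 ω c x * (x - eta1 ω c x) +
        2 * √(x * (eta2 ω c x - eta1 ω c x) * (eta2 ω c x * (x - eta1 ω c x)))) / 4)
      (√(x * (eta2 ω c x - eta1 ω c x) * (eta2 ω c x * (x - eta1 ω c x)))) := by
  obtain ⟨h1, h2⟩ := gaussParam_pos h hx hx'
  rw [halfPeriod_eq h hx hx']
  have h3 := gaussIntegral_agm (Real.sqrt_pos.2 h1) (Real.sqrt_pos.2 h2)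
  have h4 := Real.sq_sqrt h1.le
  have h5 := Real.sq_sqrt h2.le
  rw [h4, h5] at h3
  rw [h3, Real.sqrt_mul h1.le]
  congr 2
  linear_combination (h4 + h5) / 4

/-- Put `N = -η₁`, `s = η₂ + η₃`, `P = η₂η₃`. Vieta gives `s = 4c + N` and `P = Ns - 4(4ω - c²)`,
while `p + q = 2P + Ns` and `pq = P(P + Ns + N²)`. As `η₃` grows, `N` decreases, hence so do `Ns`,
`P`, `p + q` and `pq`. After the mean step both arguments of the Gauss integral thus decrease. -/
theorem halfPeriod_strictMonoOn (h : Admissible ω c) :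
    StrictMonoOn (halfPeriod ω c) (Ico (alpha0 ω c) (solitonPeak ω c)) := by
  intro x hx y hy hxy
  have hx0 := (alpha0_pos h).trans_le hx.1
  have hy0 := (alpha0_pos h).trans_le hy.1
  have hη := eta1_lt_eta1 h hx.1 hxy hy.2
  have hyneg := eta1_neg h hy0 hy.2
  have hsx := eta1_add_eta2 ω c x
  have hsy := eta1_add_eta2 ω c y
  have hpx := eta_pair_sum h hx0 hx.2
  have hpy := eta_pair_sum h hy0 hy.2
  have hx2 := eta2_pos h hx0 hx.2
  have hy2 := eta2_pos h hy0 hy.2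
  obtain ⟨hx3, hx4⟩ := gaussParam_pos h hx.1 hx.2
  obtain ⟨hy3, hy4⟩ := gaussParam_pos h hy.1 hy.2
  rw [halfPeriod_eq_agm h hx.1 hx.2, halfPeriod_eq_agm h hy.1 hy.2]
  set x₁ := eta1 ω c x
  set x₂ := eta2 ω c x
  set y₁ := eta1 ω c y
  set y₂ := eta2 ω c y
  have hNs : -y₁ * (y + y₂) < -x₁ * (x + x₂) :=
    mul_lt_mul'' (by linarith) (by linarith) (by linarith) (by linarith)
  have hP : y * y₂ < x * x₂ := by linarith
  have hsum : y * (y₂ - y₁) + y₂ * (y - y₁) < x * (x₂ - x₁) + x₂ * (x - x₁) := by linarith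
  have hprod : y * (y₂ - y₁) * (y₂ * (y - y₁)) < x * (x₂ - x₁) * (x₂ * (x - x₁)) := by
    have h1 : (y₂ - y₁) * (y - y₁) < (x₂ - x₁) * (x - x₁) := by nlinarith
    have h2 := mul_lt_mul'' hP h1 (by positivity)
      (mul_nonneg (by linarith) (by linarith))
    linarith
  have hsqrt := Real.sqrt_lt_sqrt (mul_pos hy3 hy4).le hprod
  have hpos := Real.sqrt_pos.2 (mul_pos hy3 hy4)
  have := gaussIntegral_lt (by linarith) hpos
    (by linarith : (y * (y₂ - y₁) + y₂ * (y - y₁) + 2 * √(y * (y₂ - y₁) * (y₂ * (y - y₁)))) / 4 <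
      (x * (x₂ - x₁) + x₂ * (x - x₁) + 2 * √(x * (x₂ - x₁) * (x₂ * (x - x₁)))) / 4) hsqrt
  linarith

theorem continuous_eta1 (ω c : ℝ) : Continuous (eta1 ω c) := by
  unfold eta1 polyA
  fun_prop

theorem continuous_eta2 (ω c : ℝ) : Continuous (eta2 ω c) := by
  unfold eta2 polyA
  fun_prop

theorem continuousOn_halfPeriod (h : Admissible ω c) :
    ContinuousOn (halfPeriod ω c) (Ico (alpha0 ω c) (solitonPeak ω c)) := by
  have h1 := continuous_eta1 ω c
  have h2 := continuous_eta2 ω c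
  have h3 : Continuous fun x : ℝ =>
      (x * (eta2 ω c x - eta1 ω c x), eta2 ω c x * (x - eta1 ω c x)) := by fun_prop
  exact (continuousOn_const.mul (continuousOn_gaussIntegral.comp h3.continuousOn
    fun x hx => gaussParam_pos h hx.1 hx.2)).congr fun x hx => halfPeriod_eq h hx.1 hx.2

/-- With `η₂ = η₃` the two Gauss arguments coincide and the integrand is constant; this is the limit
of small oscillations. -/
theorem halfPeriod_alpha0 (h : Admissible ω c) : halfPeriod ω c (alpha0 ω c) = L0 ω c := by
  rw [halfPeriod_eq h le_rfl (alpha0_lt_solitonPeak h), eta2_alpha0 h, gaussIntegral_self, L0]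
  nth_rewrite 2 [← eta2_alpha0 h]
  rw [eta2_sub_eta1]
  ring

theorem L0_pos (h : Admissible ω c) : 0 < L0 ω c := by
  have h1 := polyA_pos h (alpha0_pos h) (alpha0_lt_solitonPeak h)
  have h2 := alpha0_pos h
  rw [L0]
  positivity

/-- At the soliton height `η₂` vanishes, so the second Gauss argument tends to zero while the first
stays bounded, and the logarithmic lower bound diverges. Only an upper bound on the first argument
is needed, which covers `ω = c²/4`, where it also tends to zero. -/
theorem tendsto_halfPeriod (h : Admissible ω c) :
    Tendsto (halfPeriod ω c) (𝓝[<] solitonPeak ω c) atTop := by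
  have hc1 := continuous_eta1 ω c
  have hc2 := continuous_eta2 ω c
  obtain ⟨R, hR0, hR⟩ : ∃ R : ℝ, 0 < R ∧
      ∀ᶠ x in 𝓝[<] solitonPeak ω c, x * (eta2 ω c x - eta1 ω c x) < R ^ 2 := by
    have hcont : Continuous fun x : ℝ => x * (eta2 ω c x - eta1 ω c x) := by fun_prop
    refine ⟨√(|solitonPeak ω c * (eta2 ω c (solitonPeak ω c) - eta1 ω c (solitonPeak ω c))| + 1),
      by positivity, ?_⟩
    rw [Real.sq_sqrt (by positivity)]
    refine (hcont.tendsto (solitonPeak ω c)).mono_left nhdsWithin_le_nhds |>.eventually_lt_const ?_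
    exact (le_abs_self _).trans_lt (lt_add_one _)
  have hmem : ∀ᶠ x in 𝓝[<] solitonPeak ω c, x ∈ Ioo (alpha0 ω c) (solitonPeak ω c) :=
    Ioo_mem_nhdsLT (alpha0_lt_solitonPeak h)
  -- The factor two makes room for `gaussIntegral_lt`, which asks for strict inequality in both
  -- arguments.
  have hb : Tendsto (fun x : ℝ => √(2 * (eta2 ω c x * (x - eta1 ω c x))))
      (𝓝[<] solitonPeak ω c) (𝓝[>] 0) := by
    refine tendsto_nhdsWithin_iff.2 ⟨?_, ?_⟩
    · have hcont : Continuous fun x : ℝ => √(2 * (eta2 ω c x * (x - eta1 ω c x))) := by fun_prop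
      have := (hcont.tendsto (solitonPeak ω c)).mono_left
        (nhdsWithin_le_nhds (s := Iio (solitonPeak ω c)))
      simpa [eta2_solitonPeak h] using this
    · filter_upwards [hmem] with x hx
      have := (gaussParam_pos h hx.1.le hx.2).2
      exact Real.sqrt_pos.2 (by linarith)
  have hlog : Tendsto (fun b : ℝ => 4 * (log (1 + R * (π / 2) / b) / R)) (𝓝[>] 0) atTop := by
    refine Tendsto.const_mul_atTop four_pos (Tendsto.atTop_div_const hR0 ?_)
    refine tendsto_log_atTop.comp (tendsto_atTop_add_const_left _ _ ?_)
    exact Tendsto.const_mul_atTop (by positivity) tendsto_inv_nhdsGT_zero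
  refine tendsto_atTop_mono' _ ?_ (hlog.comp hb)
  filter_upwards [hmem, hR] with x hx hxR
  obtain ⟨h1, h2⟩ := gaussParam_pos h hx.1.le hx.2
  have h3 := log_le_gaussIntegral hR0
    (Real.sqrt_pos.2 (by linarith : 0 < 2 * (eta2 ω c x * (x - eta1 ω c x))))
  rw [Real.sq_sqrt (by linarith)] at h3
  have h4 := gaussIntegral_lt h1 h2 hxR
    (by linarith : eta2 ω c x * (x - eta1 ω c x) < 2 * (eta2 ω c x * (x - eta1 ω c x)))
  rw [halfPeriod_eq h hx.1.le hx.2]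
  simp only [Function.comp_apply]
  linarith

theorem exists_halfPeriod_eq (h : Admissible ω c) {L : ℝ} (hL : L0 ω c < L) :
    ∃ x ∈ Ioo (alpha0 ω c) (solitonPeak ω c), halfPeriod ω c x = L := by
  obtain ⟨y, hyL, hy⟩ := (((tendsto_halfPeriod h).eventually_gt_atTop L).and
    (Ioo_mem_nhdsLT (alpha0_lt_solitonPeak h))).exists
  have hcont := (continuousOn_halfPeriod h).mono
    (Icc_subset_Ico_right hy.2)
  obtain ⟨x, hx, hxL⟩ := intermediate_value_Icc hy.1.le hcont
    ⟨(halfPeriod_alpha0 h).trans_le hL.le, hyL.le⟩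
  refine ⟨x, ⟨hx.1.lt_of_ne fun hxe => ?_, hx.2.trans_lt hy.2⟩, hxL⟩
  rw [← hxe, halfPeriod_alpha0 h] at hxL
  exact hL.ne hxL

/-- Strict monotonicity suffices: once `L` exceeds the half-period at `max y α₀`, the root `η L`
exceeds `y`. -/
theorem tendsto_solitonPeak_of_halfPeriod_eq (h : Admissible ω c) {η : ℝ → ℝ}
    (hη : ∀ L, L0 ω c < L →
      η L ∈ Ioo (alpha0 ω c) (solitonPeak ω c) ∧ halfPeriod ω c (η L) = L) :
    Tendsto η atTop (𝓝 (solitonPeak ω c)) := by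
  refine tendsto_order.2 ⟨fun y hy => ?_, fun y hy => ?_⟩
  · have hz : max y (alpha0 ω c) ∈ Ico (alpha0 ω c) (solitonPeak ω c) :=
      ⟨le_max_right _ _, max_lt hy (alpha0_lt_solitonPeak h)⟩
    filter_upwards [eventually_gt_atTop (L0 ω c),
      eventually_gt_atTop (halfPeriod ω c (max y (alpha0 ω c)))] with L hL hL'
    obtain ⟨h1, h2⟩ := hη L hL
    rw [← h2, (halfPeriod_strictMonoOn h).lt_iff_lt hz ⟨h1.1.le, h1.2⟩] at hL'
    exact (le_max_left _ _).trans_lt hL'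
  · filter_upwards [eventually_gt_atTop (L0 ω c)] with L hL
    exact (hη L hL).1.2.trans hy

end Roots

/-! ### The stationary equation as a first-order system -/

/-- The nonlinearity in `Φ'' = force Φ`. -/
def force (ω c y : ℝ) : ℝ := (ω - c ^ 2 / 4) * y + c / 2 * y ^ 3 - 3 / 16 * y ^ 5

/-- `(y, z)` solves the system `y' = z`, `z' = force y`. -/
def SolvesSystem (ω c : ℝ) (y z : ℝ → ℝ) : Prop :=
  ∀ x, HasDerivAt y (z x) x ∧ HasDerivAt z (force ω c (y x)) x

section System

variable {ω c : ℝ}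

theorem SolvesSystem.shift {y z : ℝ → ℝ} (h : SolvesSystem ω c y z) (a : ℝ) :
    SolvesSystem ω c (fun x => y (x + a)) (fun x => z (x + a)) :=
  fun x => ⟨(h (x + a)).1.comp_add_const x a, (h (x + a)).2.comp_add_const x a⟩

/-- Time reversal, which carries estimates for positive times over to negative times. -/
theorem SolvesSystem.reflect {y z : ℝ → ℝ} (h : SolvesSystem ω c y z) :
    SolvesSystem ω c (fun x => y (-x)) (fun x => -z (-x)) := fun x => by
  have h1 := (h (-x)).1.comp x (hasDerivAt_neg x)
  have h2 := ((h (-x)).2.comp x (hasDerivAt_neg x)).fun_neg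
  rw [mul_neg_one] at h1 h2
  rw [neg_neg] at h2
  exact ⟨h1, h2⟩

theorem contDiff_force (ω c : ℝ) : ContDiff ℝ 1 (force ω c) := by
  unfold force
  fun_prop

theorem IsPeriodicSolution.solvesSystem {L : ℝ} {Φ : ℝ → ℝ} (h : IsPeriodicSolution ω c L Φ) :
    SolvesSystem ω c Φ (deriv Φ) := fun x => by
  have h1 : ContDiff ℝ (1 + 1) Φ := by simpa [one_add_one_eq_two] using h.contDiff
  have h2 := (contDiff_succ_iff_deriv.1 h1).2.2.differentiable one_ne_zero
  refine ⟨(h.contDiff.differentiable two_ne_zero x).hasDerivAt, ?_⟩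
  refine (h2 x).hasDerivAt.congr_deriv ?_
  have h3 := h.equation x
  have h4 : |Φ x| ^ 4 = Φ x ^ 4 := by
    rw [show (4 : ℕ) = 2 * 2 from rfl, pow_mul, sq_abs, ← pow_mul]
  rw [sq_abs, h4] at h3
  rw [force]
  linear_combination -h3

theorem SolvesSystem.isPeriodicSolution {L : ℝ} {y z : ℝ → ℝ} (h : SolvesSystem ω c y z)
    (hper : Function.Periodic y (2 * L)) : IsPeriodicSolution ω c L y := by
  have hy : deriv y = z := funext fun x => (h x).1.deriv
  have hz : deriv z = fun x => force ω c (y x) := funext fun x => (h x).2.deriv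
  have hyd : Differentiable ℝ y := fun x => (h x).1.differentiableAt
  have hzd : Differentiable ℝ z := fun x => (h x).2.differentiableAt
  refine ⟨hper, ?_, fun x => ?_⟩
  · rw [← one_add_one_eq_two, contDiff_succ_iff_deriv, hy, contDiff_one_iff_deriv, hz]
    exact ⟨hyd, by simp, hzd, (contDiff_force ω c).continuous.comp hyd.continuous⟩
  · have h4 : |y x| ^ 4 = y x ^ 4 := by
      rw [show (4 : ℕ) = 2 * 2 from rfl, pow_mul, sq_abs, ← pow_mul]
    rw [hy, hz, sq_abs, h4]
    simp only [force]
    ring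

theorem SolvesSystem.energy_eq {y z : ℝ → ℝ} (h : SolvesSystem ω c y z) (s t : ℝ) :
    z s ^ 2 - ((ω - c ^ 2 / 4) * y s ^ 2 + c / 4 * y s ^ 4 - 1 / 16 * y s ^ 6) =
      z t ^ 2 - ((ω - c ^ 2 / 4) * y t ^ 2 + c / 4 * y t ^ 4 - 1 / 16 * y t ^ 6) := by
  have hd : ∀ x, HasDerivAt (fun x => z x ^ 2 -
      ((ω - c ^ 2 / 4) * y x ^ 2 + c / 4 * y x ^ 4 - 1 / 16 * y x ^ 6)) 0 x := fun x => by
    obtain ⟨hy, hz⟩ := h x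
    refine ((hz.pow 2).sub ((((hy.pow 2).const_mul (ω - c ^ 2 / 4)).add
      ((hy.pow 4).const_mul (c / 4))).sub ((hy.pow 6).const_mul (1 / 16)))).congr_deriv ?_
    rw [force]
    push_cast
    ring
  exact is_const_of_deriv_eq_zero (fun x => (hd x).differentiableAt) (fun x => (hd x).deriv) s t

/-- The square root of a positive solution of the equation satisfied by `Φ²`. -/
theorem solvesSystem_sqrt {φ φ₁ φ₂ : ℝ → ℝ} (E : ℝ) (hpos : ∀ x, 0 < φ x)
    (h1 : ∀ x, HasDerivAt φ (φ₁ x) x) (h2 : ∀ x, HasDerivAt φ₁ (φ₂ x) x)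
    (hE : ∀ x, φ₁ x ^ 2 =
      (4 * ω - c ^ 2) * φ x ^ 2 + c * φ x ^ 3 - φ x ^ 4 / 4 + E * φ x)
    (hφ₂ : ∀ x, 2 * φ₂ x = 2 * (4 * ω - c ^ 2) * φ x + 3 * c * φ x ^ 2 - φ x ^ 3 + E) :
    SolvesSystem ω c (fun x => √(φ x)) (fun x => φ₁ x / (2 * √(φ x))) := fun x => by
  have hs := Real.sqrt_pos.2 (hpos x)
  have hd := (h1 x).sqrt (hpos x).ne'
  refine ⟨hd, ((h2 x).div (hd.const_mul 2) (by positivity)).congr_deriv ?_⟩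
  have hE := hE x
  have hφ := hφ₂ x
  have hsq := Real.sq_sqrt (hpos x).le
  rw [force]
  -- Here `r'' = φ₂/(2r) - φ₁²/(4r³)`, and the constant `E` cancels between the two hypotheses.
  set r := √(φ x)
  rw [← hsq] at hE hφ
  field_simp
  linear_combination 64 * r ^ 2 * hφ - 64 * hE

/-- The field is linear in the second coordinate, so bounding the first alone gives a Lipschitz
constant, although `force` is not globally Lipschitz. -/
theorem exists_lipschitzOnWith_system (ω c R : ℝ) :
    ∃ K, LipschitzOnWith K (fun p : ℝ × ℝ => (p.2, force ω c p.1)) {p | |p.1| ≤ R} := by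
  obtain ⟨K, hK⟩ := (contDiff_force ω c).locallyLipschitz.locallyLipschitzOn
    |>.exists_lipschitzOnWith_of_compact (isCompact_Icc (a := -R) (b := R))
  refine ⟨max 1 K, LipschitzOnWith.of_dist_le_mul fun p hp q hq => ?_⟩
  have h1 := hK.dist_le_mul p.1 (abs_le.1 hp) q.1 (abs_le.1 hq)
  simp only [Prod.dist_eq, NNReal.coe_max, NNReal.coe_one]
  have h2 := le_max_left (1 : ℝ) K
  have h3 := le_max_right (1 : ℝ) K
  have h4 := le_max_left (dist p.1 q.1) (dist p.2 q.2)
  have h5 := le_max_right (dist p.1 q.1) (dist p.2 q.2)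
  refine max_le ?_ (h1.trans ?_)
  · nlinarith [dist_nonneg (x := p.2) (y := q.2)]
  · exact mul_le_mul h3 h4 dist_nonneg (by linarith)

/-- Solutions with values in a bounded set depend continuously on their initial values. -/
theorem exists_dist_le_exp (ω c R : ℝ) : ∃ K : ℝ, ∀ y z y' z' : ℝ → ℝ,
    SolvesSystem ω c y z → SolvesSystem ω c y' z' → (∀ x, |y x| ≤ R) → (∀ x, |y' x| ≤ R) →
    z 0 = z' 0 → ∀ x, |y x - y' x| ≤ |y 0 - y' 0| * exp (K * |x|) := by
  obtain ⟨K, hK⟩ := exists_lipschitzOnWith_system ω c R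
  have key : ∀ y z y' z' : ℝ → ℝ,
      SolvesSystem ω c y z → SolvesSystem ω c y' z' → (∀ x, |y x| ≤ R) → (∀ x, |y' x| ≤ R) →
      z 0 = z' 0 → ∀ x, 0 ≤ x → |y x - y' x| ≤ |y 0 - y' 0| * exp (K * x) := by
    intro y z y' z' h h' hR hR' h0 x hx
    have hd := fun t => (h t).1.prodMk (h t).2
    have hd' := fun t => (h' t).1.prodMk (h' t).2
    have := dist_le_of_trajectories_ODE_of_mem (a := 0) (b := x) (δ := |y 0 - y' 0|)
      (v := fun _ p => (p.2, force ω c p.1)) (s := fun _ => {p : ℝ × ℝ | |p.1| ≤ R})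
      (f := fun t => (y t, z t)) (g := fun t => (y' t, z' t)) (fun _ _ => hK)
      (fun t _ => (hd t).continuousAt.continuousWithinAt) (fun t _ => (hd t).hasDerivWithinAt)
      (fun t _ => hR t)
      (fun t _ => (hd' t).continuousAt.continuousWithinAt) (fun t _ => (hd' t).hasDerivWithinAt)
      (fun t _ => hR' t) (by simp [Prod.dist_eq, h0, Real.dist_eq]) x ⟨hx, le_rfl⟩
    rw [sub_zero] at this
    exact (le_max_left _ _).trans this
  refine ⟨K, fun y z y' z' h h' hR hR' h0 x => ?_⟩
  rcases le_total 0 x with hx | hx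
  · rw [abs_of_nonneg hx]
    exact key y z y' z' h h' hR hR' h0 x hx
  · rw [abs_of_nonpos hx]
    have := key _ _ _ _ h.reflect h'.reflect (fun t => hR (-t)) (fun t => hR' (-t))
      (by simp [h0]) (-x) (by linarith)
    simpa using this

theorem SolvesSystem.eq_of_bounded {R : ℝ} {y z y' z' : ℝ → ℝ} (h : SolvesSystem ω c y z)
    (h' : SolvesSystem ω c y' z') (hR : ∀ x, |y x| ≤ R) (hR' : ∀ x, |y' x| ≤ R)
    (hy : y 0 = y' 0) (hz : z 0 = z' 0) : y = y' := by
  obtain ⟨K, hK⟩ := exists_dist_le_exp ω c R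
  ext x
  have := hK y z y' z' h h' hR hR' hz x
  rw [hy, sub_self, abs_zero, zero_mul] at this
  exact sub_eq_zero.1 (abs_nonpos_iff.1 this)

/-! ### The soliton -/

theorem solvesSystem_soliton (h : Admissible ω c) :
    ∃ z, SolvesSystem ω c (soliton ω c) z ∧ z 0 = 0 := by
  by_cases hc : c ^ 2 / 4 < ω
  · have h2 := Real.sqrt_pos.2 h.omega_pos
    have h3 := Real.sq_sqrt h.omega_pos.le
    have hm : 0 < 4 * ω - c ^ 2 := by linarith
    have hμ := Real.sq_sqrt hm.le
    set μ := √(4 * ω - c ^ 2) with hμdef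
    set r := √ω with hr
    have hcr : c < 2 * r :=
      (abs_lt_of_sq_lt_sq' (by linarith : c ^ 2 < (2 * r) ^ 2) (by positivity)).2
    have hD : ∀ x, 0 < 2 * r * cosh (μ * x) - c := fun x => by
      have := mul_le_mul_of_nonneg_left (one_le_cosh (μ * x)) (by positivity : 0 ≤ 2 * r)
      linarith
    have hsol : soliton ω c = fun x => √(2 * μ ^ 2 / (2 * r * cosh (μ * x) - c)) := by
      ext x
      rw [soliton, if_pos hc, ← hμdef, ← hr, hμ]
      congr 1
      have := (hD x).ne'
      have h5 : r * (cosh (μ * x) - c / (2 * r)) = (2 * r * cosh (μ * x) - c) / 2 := by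
        field_simp
      rw [h5]
      field_simp
    have hDd : ∀ x, HasDerivAt (fun x => 2 * r * cosh (μ * x) - c)
        (2 * r * (sinh (μ * x) * μ)) x := fun x => by
      have := ((hasDerivAt_id x).const_mul μ).cosh
      simpa using (this.const_mul (2 * r)).sub_const c
    have hSd : ∀ x, HasDerivAt (fun x => 2 * r * (sinh (μ * x) * μ))
        (2 * r * (cosh (μ * x) * μ * μ)) x := fun x => by
      have := ((hasDerivAt_id x).const_mul μ).sinh
      simpa using (this.mul_const μ).const_mul (2 * r)
    have hcosh : ∀ x, sinh (μ * x) ^ 2 = cosh (μ * x) ^ 2 - 1 := fun x => by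
      linarith [cosh_sq (μ * x)]
    rw [hsol]
    -- The integration constant is zero because a root of the cubic vanishes at the soliton.
    refine ⟨_, solvesSystem_sqrt (ω := ω) (c := c) 0
      (φ₁ := fun x => -(2 * μ ^ 2 * (2 * r * (sinh (μ * x) * μ))) /
        (2 * r * cosh (μ * x) - c) ^ 2)
      (φ₂ := fun x => (-(2 * μ ^ 2 * (2 * r * (cosh (μ * x) * μ * μ))) *
          (2 * r * cosh (μ * x) - c) ^ 2 - -(2 * μ ^ 2 * (2 * r * (sinh (μ * x) * μ))) *
          (2 * (2 * r * cosh (μ * x) - c) * (2 * r * (sinh (μ * x) * μ)))) /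
        ((2 * r * cosh (μ * x) - c) ^ 2) ^ 2) ?_ ?_ ?_ ?_ ?_, ?_⟩
    · intro x
      have := hD x
      have : 0 < μ ^ 2 := hμ ▸ hm
      positivity
    · intro x
      refine ((hasDerivAt_const x (2 * μ ^ 2)).div (hDd x) (hD x).ne').congr_deriv ?_
      simp
    · intro x
      refine (((hSd x).const_mul (2 * μ ^ 2)).neg.div ((hDd x).pow 2)
        (pow_ne_zero 2 (hD x).ne')).congr_deriv ?_
      simp
    · intro x
      have hd := (hD x).ne'
      have e1 := hcosh x
      have e2 : r ^ 2 = (μ ^ 2 + c ^ 2) / 4 := by linarith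
      rw [← hμ]
      set S := sinh (μ * x)
      set C := cosh (μ * x)
      field_simp
      linear_combination 32 * μ ^ 6 * r ^ 2 * e1 - 32 * μ ^ 6 * e2
    · intro x
      have hd := (hD x).ne'
      have e1 := hcosh x
      have e2 : r ^ 2 = (μ ^ 2 + c ^ 2) / 4 := by linarith
      rw [← hμ]
      set S := sinh (μ * x)
      set C := cosh (μ * x)
      field_simp
      linear_combination 32 * μ ^ 4 * r ^ 2 * e1 - 32 * μ ^ 4 * e2
    · simp
  · obtain ⟨hω, hc0⟩ := h.resolve_left hc
    have hD : ∀ x, 0 < (c * x) ^ 2 + 1 := fun x => by positivity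
    have hsol : soliton ω c = fun x => √(4 * c / ((c * x) ^ 2 + 1)) := by
      ext x
      rw [soliton, if_neg hc]
    have hDd : ∀ x, HasDerivAt (fun x => (c * x) ^ 2 + 1) (2 * (c * x) * c) x := fun x => by
      simpa using (((hasDerivAt_id x).const_mul c).pow 2).add_const 1
    rw [hsol]
    refine ⟨_, solvesSystem_sqrt (ω := ω) (c := c) 0
      (φ₁ := fun x => -(4 * c * (2 * (c * x) * c)) / ((c * x) ^ 2 + 1) ^ 2)
      (φ₂ := fun x => (-(4 * c * (2 * c * c)) * ((c * x) ^ 2 + 1) ^ 2 -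
          -(4 * c * (2 * (c * x) * c)) * (2 * ((c * x) ^ 2 + 1) * (2 * (c * x) * c))) /
        (((c * x) ^ 2 + 1) ^ 2) ^ 2) ?_ ?_ ?_ ?_ ?_, ?_⟩
    · intro x
      positivity
    · intro x
      refine ((hasDerivAt_const x (4 * c)).div (hDd x) (hD x).ne').congr_deriv ?_
      simp
    · intro x
      have h1 : HasDerivAt (fun x => -(4 * c * (2 * (c * x) * c))) (-(4 * c * (2 * c * c))) x := by
        simpa using (((((hasDerivAt_id x).const_mul c).const_mul 2).mul_const c).const_mul
          (4 * c)).fun_neg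
      refine (h1.div ((hDd x).pow 2) (pow_ne_zero 2 (hD x).ne')).congr_deriv ?_
      simp
    · intro x
      have hd := (hD x).ne'
      rw [hω]
      field_simp
      ring
    · intro x
      have hd := (hD x).ne'
      rw [hω]
      field_simp
      ring
    · simp

theorem soliton_nonneg (ω c x : ℝ) : 0 ≤ soliton ω c x := by
  rw [soliton]
  split_ifs <;> exact Real.sqrt_nonneg _

theorem soliton_le_soliton_zero (h : Admissible ω c) (x : ℝ) :
    soliton ω c x ≤ soliton ω c 0 := by
  rw [soliton, soliton]
  split_ifs with hc
  · have h2 := Real.sqrt_pos.2 h.omega_pos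
    have h3 := Real.sq_sqrt h.omega_pos.le
    have h5 : c < 2 * √ω :=
      (abs_lt_of_sq_lt_sq' (by linarith : c ^ 2 < (2 * √ω) ^ 2) (by positivity)).2
    have h6 : c / (2 * √ω) < 1 := by rwa [div_lt_one (by positivity)]
    refine Real.sqrt_le_sqrt (div_le_div_of_nonneg_left (by linarith) ?_ ?_)
    · rw [mul_zero, cosh_zero]
      exact mul_pos h2 (by linarith)
    · rw [mul_zero, cosh_zero]
      have := one_le_cosh (√(4 * ω - c ^ 2) * x)
      gcongr
  · have hc0 := (h.resolve_left hc).2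
    refine Real.sqrt_le_sqrt (div_le_div_of_nonneg_left (by linarith) (by positivity) ?_)
    nlinarith [sq_nonneg (c * x)]

end System

/-! ### The periodic solutions -/

/-- The dnoidal profile whose square has maximum `η₃`. -/
def dnoidal (ω c η₃ t : ℝ) : ℝ :=
  √(η₃ * (jacobiDn (t / (2 * gParam ω c η₃)) (modulus ω c η₃) ^ 2 /
    (1 + betaParam ω c η₃ ^ 2 * jacobiSn (t / (2 * gParam ω c η₃)) (modulus ω c η₃) ^ 2)))

/-- The square of the profile with roots `p < q < r` as a function of `S = sn²`. -/
def profile (p q r S : ℝ) : ℝ := (r * (q - p) + p * (r - q) * S) / (q - p + (r - q) * S)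

/-- A Möbius function of `S` with determinant `-(r - q)(r - p)(q - p) < 0`. -/
theorem profile_strictAntiOn {p q r : ℝ} (hp : p < 0) (hq : 0 < q) (hqr : q < r) :
    StrictAntiOn (profile p q r) (Ici 0) := by
  intro S hS T hT hST
  have hqp : 0 < q - p := by linarith
  have hrq : 0 < r - q := by linarith
  have hrp : 0 < r - p := by linarith
  have h1 := mul_nonneg hrq.le hS
  have h2 := mul_nonneg hrq.le hT
  rw [profile, profile, div_lt_div_iff₀ (by linarith) (by linarith)]
  have h3 := mul_pos (mul_pos (mul_pos hrq hrp) hqp) (sub_pos.2 hST)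
  nlinarith

theorem profile_zero {p q r : ℝ} (hqp : p < q) : profile p q r 0 = r := by
  have : q - p ≠ 0 := by linarith
  simp [profile, this]

theorem profile_pos {p q r S : ℝ} (hp : p < 0) (hq : 0 < q) (hqr : q < r) (h0 : 0 ≤ S)
    (h1 : S ≤ 1) : 0 < profile p q r S := by
  have h2 := mul_nonneg (by linarith : 0 ≤ r - q) h0
  refine div_pos ?_ (by linarith)
  -- The numerator equals `q(r - p) + (-p)(r - q)(1 - S)`.
  have h3 := mul_nonneg (mul_nonneg (by linarith : 0 ≤ -p) (by linarith : 0 ≤ r - q))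
    (sub_nonneg.2 h1)
  have h4 := mul_pos hq (by linarith : 0 < r - p)
  nlinarith

section Dnoidal

variable {ω c x : ℝ}

theorem betaParam_sq (h : Admissible ω c) (hx : x ∈ Ioo (alpha0 ω c) (solitonPeak ω c)) :
    betaParam ω c x ^ 2 = (x - eta2 ω c x) / (eta2 ω c x - eta1 ω c x) := by
  have h0 := (alpha0_pos h).trans hx.1
  have h1 := (eta1_neg h h0 hx.2).ne
  have h2 : eta2 ω c x - eta1 ω c x ≠ 0 := by
    have := eta1_neg h h0 hx.2
    have := eta2_pos h h0 hx.2
    linarith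
  rw [betaParam, Real.sq_sqrt (betaParam_arg_pos h hx.1 hx.2).le, modulus_sq h hx.1.le hx.2]
  field_simp

theorem gParam_sq (h : Admissible ω c) (hx : x ∈ Ioo (alpha0 ω c) (solitonPeak ω c)) :
    1 / gParam ω c x ^ 2 = x * (eta2 ω c x - eta1 ω c x) / 4 := by
  rw [gParam, div_pow, Real.sq_sqrt (gaussParam_pos h hx.1.le hx.2).1.le, one_div_div]
  norm_num

/-- Only `k²` and `β²` enter, so once `dn² = 1 - k² sn²` is used the coefficients are rational in
the roots. -/
theorem dnoidal_eq_sqrt_profile (h : Admissible ω c)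
    (hx : x ∈ Ioo (alpha0 ω c) (solitonPeak ω c)) (t : ℝ) :
    dnoidal ω c x t = √(profile (eta1 ω c x) (eta2 ω c x) x
      (jacobiSn (t / (2 * gParam ω c x)) (modulus ω c x) ^ 2)) := by
  have h0 := (alpha0_pos h).trans hx.1
  have h1 := eta1_neg h h0 hx.2
  have h2 := eta2_pos h h0 hx.2
  have h3 := eta2_lt h hx.1
  rw [dnoidal, jacobiDn_sq (modulus_nonneg _ _ _) (modulus_lt_one h hx.1.le hx.2),
    betaParam_sq h hx, modulus_sq h hx.1.le hx.2, profile]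
  set S := jacobiSn (t / (2 * gParam ω c x)) (modulus ω c x) ^ 2
  have hS : 0 ≤ S := sq_nonneg _
  have h4 := mul_nonneg (sub_nonneg.2 h3.le) hS
  have h5 : eta2 ω c x - eta1 ω c x ≠ 0 := by linarith
  have h6 : eta2 ω c x - eta1 ω c x + (x - eta2 ω c x) * S ≠ 0 := by
    have : 0 < eta2 ω c x - eta1 ω c x + (x - eta2 ω c x) * S := by linarith
    exact this.ne'
  have h7 : 1 + (x - eta2 ω c x) / (eta2 ω c x - eta1 ω c x) * S =
      (eta2 ω c x - eta1 ω c x + (x - eta2 ω c x) * S) / (eta2 ω c x - eta1 ω c x) := by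
    field_simp
  congr 1
  rw [h7]
  field_simp
  ring

theorem dnoidal_pos (h : Admissible ω c) (hx : x ∈ Ioo (alpha0 ω c) (solitonPeak ω c)) (t : ℝ) :
    0 < dnoidal ω c x t := by
  have h0 := (alpha0_pos h).trans hx.1
  rw [dnoidal_eq_sqrt_profile h hx]
  exact Real.sqrt_pos.2 (profile_pos (eta1_neg h h0 hx.2) (eta2_pos h h0 hx.2) (eta2_lt h hx.1)
    (sq_nonneg _) (sin_sq_le_one _))

theorem dnoidal_le (h : Admissible ω c) (hx : x ∈ Ioo (alpha0 ω c) (solitonPeak ω c)) (t : ℝ) :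
    dnoidal ω c x t ≤ √x := by
  have h0 := (alpha0_pos h).trans hx.1
  have h1 := eta1_neg h h0 hx.2
  have h2 := eta2_pos h h0 hx.2
  rw [dnoidal_eq_sqrt_profile h hx]
  refine Real.sqrt_le_sqrt (((profile_strictAntiOn h1 h2 (eta2_lt h hx.1)).antitoneOn
    self_mem_Ici (mem_Ici.2 (sq_nonneg _)) (sq_nonneg _)).trans_eq ?_)
  exact profile_zero (h1.trans h2)

theorem dnoidal_zero (h : Admissible ω c) (hx : x ∈ Ioo (alpha0 ω c) (solitonPeak ω c)) :
    dnoidal ω c x 0 = √x := by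
  have h0 := (alpha0_pos h).trans hx.1
  rw [dnoidal_eq_sqrt_profile h hx, zero_div,
    jacobiSn_zero (modulus_nonneg _ _ _) (modulus_lt_one h hx.1.le hx.2), zero_pow two_ne_zero,
    profile_zero ((eta1_neg h h0 hx.2).trans (eta2_pos h h0 hx.2))]

/-- Only `sn²` enters, and its period is `2K`, half that of `sn`. -/
theorem dnoidal_periodic (h : Admissible ω c) (hx : x ∈ Ioo (alpha0 ω c) (solitonPeak ω c)) :
    Function.Periodic (dnoidal ω c x) (2 * halfPeriod ω c x) := fun t => by
  have hg := (gParam_pos h hx.1.le hx.2).ne'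
  have h1 : (t + 2 * halfPeriod ω c x) / (2 * gParam ω c x) =
      t / (2 * gParam ω c x) + 2 * ellipticK (modulus ω c x) := by
    rw [halfPeriod]
    field_simp
  rw [dnoidal_eq_sqrt_profile h hx, dnoidal_eq_sqrt_profile h hx, h1,
    jacobiSn_sq_add_two_ellipticK (modulus_nonneg _ _ _) (modulus_lt_one h hx.1.le hx.2)]

theorem halfPeriod_pos (h : Admissible ω c) (hx : x ∈ Ioo (alpha0 ω c) (solitonPeak ω c)) :
    0 < halfPeriod ω c x :=
  mul_pos (mul_pos two_pos (gParam_pos h hx.1.le hx.2))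
    (ellipticK_pos (modulus_nonneg _ _ _) (modulus_lt_one h hx.1.le hx.2))

theorem dnoidal_lt_dnoidal (h : Admissible ω c)
    (hx : x ∈ Ioo (alpha0 ω c) (solitonPeak ω c)) {s t : ℝ}
    (hst : jacobiSn (s / (2 * gParam ω c x)) (modulus ω c x) ^ 2 <
      jacobiSn (t / (2 * gParam ω c x)) (modulus ω c x) ^ 2) :
    dnoidal ω c x t < dnoidal ω c x s := by
  have h0 := (alpha0_pos h).trans hx.1
  have h1 := eta1_neg h h0 hx.2
  have h2 := eta2_pos h h0 hx.2
  have h3 := eta2_lt h hx.1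
  rw [dnoidal_eq_sqrt_profile h hx, dnoidal_eq_sqrt_profile h hx]
  exact Real.sqrt_lt_sqrt (profile_pos h1 h2 h3 (sq_nonneg _) (sin_sq_le_one _)).le
    (profile_strictAntiOn h1 h2 h3 (mem_Ici.2 (sq_nonneg _)) (mem_Ici.2 (sq_nonneg _)) hst)

theorem dnoidal_strictAntiOn (h : Admissible ω c)
    (hx : x ∈ Ioo (alpha0 ω c) (solitonPeak ω c)) :
    StrictAntiOn (dnoidal ω c x) (Icc 0 (halfPeriod ω c x)) := by
  intro s hs t ht hst
  have hg : 0 < 2 * gParam ω c x := mul_pos two_pos (gParam_pos h hx.1.le hx.2)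
  have hmem : ∀ u ∈ Icc 0 (halfPeriod ω c x),
      u / (2 * gParam ω c x) ∈ Icc 0 (ellipticK (modulus ω c x)) := fun u hu =>
    ⟨div_nonneg hu.1 hg.le, (div_le_iff₀' hg).2 hu.2⟩
  exact dnoidal_lt_dnoidal h hx (strictMonoOn_jacobiSn_sq (modulus_nonneg _ _ _)
    (modulus_lt_one h hx.1.le hx.2) (hmem s hs) (hmem t ht) (by gcongr))

theorem dnoidal_strictMonoOn (h : Admissible ω c)
    (hx : x ∈ Ioo (alpha0 ω c) (solitonPeak ω c)) :
    StrictMonoOn (dnoidal ω c x) (Icc (halfPeriod ω c x) (2 * halfPeriod ω c x)) := by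
  intro s hs t ht hst
  have hg : 0 < 2 * gParam ω c x := mul_pos two_pos (gParam_pos h hx.1.le hx.2)
  have hmem : ∀ u ∈ Icc (halfPeriod ω c x) (2 * halfPeriod ω c x),
      u / (2 * gParam ω c x) ∈
        Icc (ellipticK (modulus ω c x)) (2 * ellipticK (modulus ω c x)) := fun u hu => by
    refine ⟨(le_div_iff₀' hg).2 hu.1, (div_le_iff₀' hg).2 (hu.2.trans_eq ?_)⟩
    rw [halfPeriod]; ring
  exact dnoidal_lt_dnoidal h hx (strictAntiOn_jacobiSn_sq (modulus_nonneg _ _ _)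
    (modulus_lt_one h hx.1.le hx.2) (hmem s hs) (hmem t ht) (by gcongr))

/-- With `S = sn²` and `V = sn cn dn` one has `S' = V/g` and `V² = S(1 - S)(1 - k²S)`. The squared
profile is Möbius in `S`, so the hypotheses of `solvesSystem_sqrt` become rational identities in `S`
and the roots once `ω` and `c` are eliminated by Vieta. -/
theorem solvesSystem_dnoidal (h : Admissible ω c)
    (hx : x ∈ Ioo (alpha0 ω c) (solitonPeak ω c)) :
    ∃ z, SolvesSystem ω c (dnoidal ω c x) z ∧ z 0 = 0 := by
  have h0 := (alpha0_pos h).trans hx.1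
  have h1 := eta1_neg h h0 hx.2
  have h2 := eta2_pos h h0 hx.2
  have h3 := eta2_lt h hx.1
  have hk0 := modulus_nonneg ω c x
  have hk1 := modulus_lt_one h hx.1.le hx.2
  have hg := gParam_pos h hx.1.le hx.2
  have hsum := eta1_add_eta2 ω c x
  have hpair := eta_pair_sum h h0 hx.2
  have hk2 := modulus_sq h hx.1.le hx.2
  have hg2 := gParam_sq h hx
  have hpr := fun t => dnoidal_eq_sqrt_profile h hx t
  rw [funext hpr]
  set p := eta1 ω c x
  set q := eta2 ω c x
  set k := modulus ω c x
  set g := gParam ω c x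
  let S : ℝ → ℝ := fun t => jacobiSn (t / (2 * g)) k ^ 2
  let V : ℝ → ℝ := fun t => jacobiSn (t / (2 * g)) k * cos (jacobiAm k (t / (2 * g))) *
    jacobiDn (t / (2 * g)) k
  let V' : ℝ → ℝ := fun t => ((1 - 2 * S t) * (1 - k ^ 2 * S t) - k ^ 2 * S t * (1 - S t)) / (2 * g)
  let D : ℝ → ℝ := fun t => q - p + (x - q) * S t
  have hqp : 0 < q - p := by linarith
  have hS0 : ∀ t, 0 ≤ S t := fun t => sq_nonneg _
  have hD : ∀ t, 0 < D t := fun t => by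
    have := mul_nonneg (sub_nonneg.2 h3.le) (hS0 t)
    simp only [D]
    linarith
  have hdn : ∀ t, jacobiDn (t / (2 * g)) k ^ 2 = 1 - k ^ 2 * S t := fun t =>
    jacobiDn_sq hk0 hk1 _
  have hcn : ∀ t, cos (jacobiAm k (t / (2 * g))) ^ 2 = 1 - S t := fun t => by
    have := sin_sq_add_cos_sq (jacobiAm k (t / (2 * g)))
    simp only [S, jacobiSn]
    linarith
  have hlin : ∀ t : ℝ, HasDerivAt (fun t => t / (2 * g)) (1 / (2 * g)) t := fun t =>
    (hasDerivAt_id t).div_const _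
  have hsnd : ∀ t, HasDerivAt (fun t => jacobiSn (t / (2 * g)) k)
      (cos (jacobiAm k (t / (2 * g))) * jacobiDn (t / (2 * g)) k * (1 / (2 * g))) t := fun t =>
    (hasDerivAt_jacobiSn hk0 hk1 _).comp t (hlin t)
  have hcnd : ∀ t, HasDerivAt (fun t => cos (jacobiAm k (t / (2 * g))))
      (-sin (jacobiAm k (t / (2 * g))) * jacobiDn (t / (2 * g)) k * (1 / (2 * g))) t := fun t =>
    ((hasDerivAt_jacobiAm hk0 hk1 _).cos).comp t (hlin t)
  have hdnd : ∀ t, HasDerivAt (fun t => jacobiDn (t / (2 * g)) k)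
      (-k ^ 2 * jacobiSn (t / (2 * g)) k * cos (jacobiAm k (t / (2 * g))) * (1 / (2 * g))) t :=
    fun t => (hasDerivAt_jacobiDn hk0 hk1 _).comp t (hlin t)
  have hSd : ∀ t, HasDerivAt S (V t / g) t := fun t => by
    refine ((hsnd t).pow 2).congr_deriv ?_
    simp only [V]
    field_simp
    push_cast
    ring
  have hVd : ∀ t, HasDerivAt V (V' t) t := fun t => by
    refine (((hsnd t).mul (hcnd t)).mul (hdnd t)).congr_deriv ?_
    have e1 := hdn t
    have e2 := hcn t
    have e3 : sin (jacobiAm k (t / (2 * g))) = jacobiSn (t / (2 * g)) k := rfl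
    have e4 : S t = jacobiSn (t / (2 * g)) k ^ 2 := rfl
    simp only [V', Pi.mul_apply, e3]
    rw [e4] at e1 e2 ⊢
    set s := jacobiSn (t / (2 * g)) k
    set d := jacobiDn (t / (2 * g)) k
    set C := cos (jacobiAm k (t / (2 * g)))
    field_simp
    linear_combination (C ^ 2 - s ^ 2) * e1 + (1 - k ^ 2 * s ^ 2 - k ^ 2 * s ^ 2) * e2
  have hDd : ∀ t, HasDerivAt D ((x - q) * (V t / g)) t := fun t =>
    ((hSd t).const_mul (x - q)).const_add (q - p)
  have hVsq : ∀ t, V t ^ 2 = S t * (1 - S t) * (1 - k ^ 2 * S t) := fun t => by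
    simp only [V, mul_pow, hdn, hcn, S]
  -- Up to the constant `x(q - p)`, the factor `dn²` is the numerator of the profile.
  have hkS : ∀ t, 1 - k ^ 2 * S t = (x * (q - p) + p * (x - q) * S t) / (x * (q - p)) :=
    fun t => by
      rw [hk2]
      field_simp
      ring
  have hω : 4 * ω - c ^ 2 = -(p * q + x * (p + q)) / 4 := by linarith
  have hc : c = (p + q + x) / 4 := by linarith
  -- This constant makes the quartic equal to `-φ(φ - p)(φ - q)(φ - x)/4`.
  refine ⟨_, solvesSystem_sqrt (ω := ω) (c := c) (p * q * x / 4)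
    (φ₁ := fun t => -((x - q) * (x - p) * (q - p)) / g * (V t / D t ^ 2))
    (φ₂ := fun t => -((x - q) * (x - p) * (q - p)) / g *
      ((V' t * D t ^ 2 - V t * (2 * D t * ((x - q) * (V t / g)))) / (D t ^ 2) ^ 2))
    (fun t => profile_pos h1 h2 h3 (sq_nonneg _) (sin_sq_le_one _)) ?_ ?_ ?_ ?_, ?_⟩
  · intro t
    have hN := ((hSd t).const_mul (p * (x - q))).const_add (x * (q - p))
    refine (hN.div (hDd t) (hD t).ne').congr_deriv ?_
    have := (hD t).ne'
    field_simp
    simp only [D]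
    ring
  · intro t
    refine (((hVd t).div ((hDd t).pow 2) (pow_ne_zero 2 (hD t).ne')).const_mul _).congr_deriv ?_
    simp
  · intro t
    have hd := (hD t).ne'
    have e1 : (-((x - q) * (x - p) * (q - p)) / g * (V t / D t ^ 2)) ^ 2 =
        ((x - q) * (x - p) * (q - p)) ^ 2 * (1 / g ^ 2) * (V t ^ 2 / D t ^ 4) := by
      field_simp
    rw [e1, hg2, hVsq, hkS, hω, hc, profile]
    change _ = _ * ((x * (q - p) + p * (x - q) * S t) / D t) ^ 2 +
      _ * ((x * (q - p) + p * (x - q) * S t) / D t) ^ 3 -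
      ((x * (q - p) + p * (x - q) * S t) / D t) ^ 4 / 4 +
      _ * ((x * (q - p) + p * (x - q) * S t) / D t)
    have hDS : D t = q - p + (x - q) * S t := rfl
    field_simp
    rw [hDS]
    ring
  · intro t
    have hd := (hD t).ne'
    have e1 : 2 * (-((x - q) * (x - p) * (q - p)) / g *
        ((V' t * D t ^ 2 - V t * (2 * D t * ((x - q) * (V t / g)))) / (D t ^ 2) ^ 2)) =
        -((x - q) * (x - p) * (q - p)) * (1 / g ^ 2) *
        ((1 - 2 * S t) * (1 - k ^ 2 * S t) - (1 - (1 - k ^ 2 * S t)) * (1 - S t)) / D t ^ 2 +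
        4 * ((x - q) * (x - p) * (q - p)) * (1 / g ^ 2) * (x - q) * V t ^ 2 / D t ^ 3 := by
      simp only [V']
      field_simp
      ring
    rw [e1, hg2, hVsq, hkS, hω, hc, profile]
    change _ = _ * ((x * (q - p) + p * (x - q) * S t) / D t) +
      _ * ((x * (q - p) + p * (x - q) * S t) / D t) ^ 2 -
      ((x * (q - p) + p * (x - q) * S t) / D t) ^ 3 + _
    have hDS : D t = q - p + (x - q) * S t := rfl
    field_simp
    rw [hDS]
    ring
  · simp [V, jacobiSn_zero hk0 hk1]

theorem dnoidal_isPositiveSingleBumpSolution (h : Admissible ω c)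
    (hx : x ∈ Ioo (alpha0 ω c) (solitonPeak ω c)) :
    IsPositiveSingleBumpSolution ω c (halfPeriod ω c x) (dnoidal ω c x) := by
  obtain ⟨z, hz, -⟩ := solvesSystem_dnoidal h hx
  have hL := halfPeriod_pos h hx
  refine ⟨hz.isPeriodicSolution (dnoidal_periodic h hx), dnoidal_pos h hx,
    0, halfPeriod ω c x, hL, by linarith, dnoidal_strictAntiOn h hx, ?_⟩
  rw [zero_add]
  exact dnoidal_strictMonoOn h hx

/-- Both functions start with zero slope and stay in a common bounded strip, so their distance at a
fixed `t` is at most the difference of heights times `exp (K * |t|)`, with `K` independent of `η`.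
-/
theorem tendsto_dnoidal (h : Admissible ω c) {ι : Type*} {l : Filter ι} {η : ι → ℝ}
    (hmem : ∀ᶠ i in l, η i ∈ Ioo (alpha0 ω c) (solitonPeak ω c))
    (hη : Tendsto η l (𝓝 (solitonPeak ω c))) (t : ℝ) :
    Tendsto (fun i => dnoidal ω c (η i) t) l (𝓝 (soliton ω c t)) := by
  have hs0 : soliton ω c 0 = √(solitonPeak ω c) := by
    rw [← soliton_zero_sq h, Real.sqrt_sq (soliton_nonneg _ _ _)]
  obtain ⟨w, hw, hw0⟩ := solvesSystem_soliton h
  obtain ⟨K, hK⟩ := exists_dist_le_exp ω c √(solitonPeak ω c)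
  have hlim : Tendsto (fun i => |√(η i) - √(solitonPeak ω c)| * exp (K * |t|)) l (𝓝 0) := by
    have h1 := ((Real.continuous_sqrt.tendsto _).comp hη).sub_const √(solitonPeak ω c)
    simpa using h1.abs.mul_const (exp (K * |t|))
  refine tendsto_iff_dist_tendsto_zero.2 (squeeze_zero' (Eventually.of_forall fun _ =>
    dist_nonneg) ?_ hlim)
  filter_upwards [hmem] with i hi
  obtain ⟨z, hz, hz0⟩ := solvesSystem_dnoidal h hi
  have := hK _ z _ w hz hw
    (fun s => by
      rw [abs_of_pos (dnoidal_pos h hi s)]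
      exact (dnoidal_le h hi s).trans (Real.sqrt_le_sqrt hi.2.le))
    (fun s => by
      rw [abs_of_nonneg (soliton_nonneg ω c s), ← hs0]
      exact soliton_le_soliton_zero h s) (hz0.trans hw0.symm) t
  rwa [dnoidal_zero h hi, hs0] at this

end Dnoidal

/-! ### Uniqueness -/

section Uniqueness

theorem le_peak_of_bump {L a b : ℝ} {f : ℝ → ℝ} (hf : Function.Periodic f (2 * L)) (hab : a < b)
    (hb : b < a + 2 * L) (hanti : StrictAntiOn f (Icc a b))
    (hmono : StrictMonoOn f (Icc b (a + 2 * L))) (t : ℝ) : f b ≤ f t ∧ f t ≤ f a := by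
  obtain ⟨s, hs, hst⟩ := hf.exists_mem_Ico (by linarith) t a
  rw [hst]
  rcases le_total s b with h | h
  · exact ⟨hanti.antitoneOn ⟨hs.1, h⟩ ⟨hab.le, le_rfl⟩ h,
      hanti.antitoneOn ⟨le_rfl, hab.le⟩ ⟨hs.1, h⟩ hs.1⟩
  · refine ⟨hmono.monotoneOn ⟨le_rfl, hb.le⟩ ⟨h, hs.2.le⟩ h, ?_⟩
    rw [← hf a]
    exact hmono.monotoneOn ⟨h, hs.2.le⟩ ⟨hb.le, le_rfl⟩ hs.2.le

/-- A period `2L` shorter than the bump length `2L'` would bring the peak value back at `a + 2L`,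
strictly inside the bump, where the function lies strictly below its peak. -/
theorem le_of_bumps {L L' a b' : ℝ} {f : ℝ → ℝ} (hf : Function.Periodic f (2 * L))
    (hf' : Function.Periodic f (2 * L')) (hL : 0 < L)
    (hanti' : StrictAntiOn f (Icc a b')) (hmono' : StrictMonoOn f (Icc b' (a + 2 * L'))) :
    L' ≤ L := by
  by_contra! hlt
  have hfa : f (a + 2 * L) = f a := hf a
  rcases le_total (a + 2 * L) b' with h | h
  · exact (hanti' ⟨le_rfl, by linarith⟩ ⟨by linarith, h⟩ (by linarith)).ne hfa
  · have h1 := hmono' ⟨h, by linarith⟩ ⟨by linarith, le_rfl⟩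
      (by linarith : a + 2 * L < a + 2 * L')
    rw [hfa, hf' a] at h1
    exact h1.false

variable {ω c L : ℝ}

/-- A positive single-bump solution is a translate of a dnoidal profile of the same period. -/
theorem IsPositiveSingleBumpSolution.exists_eq_dnoidal (h : Admissible ω c) {Ψ : ℝ → ℝ}
    (hΨ : IsPositiveSingleBumpSolution ω c L Ψ) :
    ∃ x ∈ Ioo (alpha0 ω c) (solitonPeak ω c), halfPeriod ω c x = L ∧
      ∃ a, ∀ t, Ψ t = dnoidal ω c x (t - a) := by
  obtain ⟨hsol, hpos, a, b, hab, hb, hanti, hmono⟩ := hΨ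
  have hper := hsol.periodic
  have hsys := hsol.solvesSystem
  have hext := le_peak_of_bump hper hab hb hanti hmono
  have hda : deriv Ψ a = 0 := IsLocalMax.deriv_eq_zero (Eventually.of_forall fun t => (hext t).2)
  have hdb : deriv Ψ b = 0 := IsLocalMin.deriv_eq_zero (Eventually.of_forall fun t => (hext t).1)
  have hlt : Ψ b < Ψ a := hanti ⟨le_rfl, hab.le⟩ ⟨hab.le, le_rfl⟩ hab
  have hen := hsys.energy_eq a b
  rw [hda, hdb] at hen
  have hb0 := hpos b
  have ha0 := hpos a
  set M := Ψ a
  set m := Ψ b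
  have hMm : m ^ 2 < M ^ 2 := by gcongr
  -- The third root is defined by the sum rule; the pair rule is then the energy balance between
  -- peak and trough, divided by `M² - m²`.
  have hpair : (4 * c - m ^ 2 - M ^ 2) * m ^ 2 + (4 * c - m ^ 2 - M ^ 2) * M ^ 2 +
      m ^ 2 * M ^ 2 = -4 * (4 * ω - c ^ 2) := by
    have h1 : (M ^ 2 - m ^ 2) ≠ 0 := by linarith
    refine mul_left_cancel₀ h1 ?_
    linear_combination -16 * hen
  have hneg : 4 * c - m ^ 2 - M ^ 2 < 0 := by
    have h1 : 0 < m ^ 2 * M ^ 2 := by positivity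
    have h2 : (4 * c - m ^ 2 - M ^ 2) * (m ^ 2 + M ^ 2) < 0 := by linarith [h.le]
    exact neg_of_mul_neg_right (by linarith) (by positivity : 0 ≤ m ^ 2 + M ^ 2)
  have hx := mem_Ioo_of_roots h hneg (pow_pos hb0 2) hMm (by ring) hpair
  obtain ⟨z, hz, hz0⟩ := solvesSystem_dnoidal h hx
  -- At the peak the initial data are `(M, 0)`, which are those of the dnoidal profile with `η₃ =
  -- M²` at the origin.
  have heq : (fun t => Ψ (t + a)) = dnoidal ω c (M ^ 2) :=
    (hsys.shift a).eq_of_bounded hz (R := M)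
      (fun t => by rw [abs_of_pos (hpos _)]; exact (hext _).2)
      (fun t => by
        rw [abs_of_pos (dnoidal_pos h hx t)]
        simpa [ha0.le] using dnoidal_le h hx t)
      (by rw [dnoidal_zero h hx, Real.sqrt_sq ha0.le, zero_add]) (by simp [hda, hz0])
  have hΨd : ∀ t, Ψ t = dnoidal ω c (M ^ 2) (t - a) := fun t => by
    rw [← heq]; simp
  have hdper : Function.Periodic (dnoidal ω c (M ^ 2)) (2 * L) := fun t => by
    rw [← heq]
    simp only
    rw [add_right_comm, hper]
  have hanti' : StrictAntiOn (dnoidal ω c (M ^ 2)) (Icc 0 (b - a)) := fun s hs t ht hst => by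
    rw [← heq]
    exact hanti ⟨by linarith [hs.1], by linarith [hs.2]⟩ ⟨by linarith [ht.1], by linarith [ht.2]⟩
      (by linarith)
  have hmono' : StrictMonoOn (dnoidal ω c (M ^ 2)) (Icc (b - a) (0 + 2 * L)) :=
    fun s hs t ht hst => by
      rw [← heq]
      exact hmono ⟨by linarith [hs.1], by linarith [hs.2]⟩
        ⟨by linarith [ht.1], by linarith [ht.2]⟩ (by linarith)
  -- The same function carries two single-bump descriptions starting at `0`, of half-lengths `L` and
  -- `halfPeriod`; each bounds the other.
  refine ⟨M ^ 2, hx, le_antisymm ?_ ?_, a, hΨd⟩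
  · exact le_of_bumps (a := 0) hdper (dnoidal_periodic h hx) (by linarith)
      (dnoidal_strictAntiOn h hx) (by rw [zero_add]; exact dnoidal_strictMonoOn h hx)
  · exact le_of_bumps (dnoidal_periodic h hx) hdper (halfPeriod_pos h hx) hanti' hmono'

end Uniqueness

end DNLS

end

/-! ### The main theorem -/

open DNLS in
theorem theorem1p1 (ω c : ℝ) (hωc : DNLS.Admissible ω c) :
    0 < DNLS.L0 ω c ∧
    ∃ (Φ : ℝ → ℝ → ℝ) (η₃ : ℝ → ℝ),
      (∀ L : ℝ, DNLS.L0 ω c < L →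
        -- existence, and uniqueness up to translation
        DNLS.IsPositiveSingleBumpSolution ω c L (Φ L) ∧
        (∀ Ψ : ℝ → ℝ, DNLS.IsPositiveSingleBumpSolution ω c L Ψ →
          ∃ a : ℝ, ∀ x : ℝ, Ψ x = Φ L (x - a)) ∧
        -- the parameters of the explicit representation
        DNLS.alpha0 ω c < η₃ L ∧ η₃ L < DNLS.soliton ω c 0 ^ 2 ∧
        DNLS.eta1 ω c (η₃ L) < 0 ∧ 0 < DNLS.eta2 ω c (η₃ L) ∧
        DNLS.eta2 ω c (η₃ L) < η₃ L ∧
        0 < DNLS.modulus ω c (η₃ L) ∧ DNLS.modulus ω c (η₃ L) < 1 ∧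
        0 < DNLS.gParam ω c (η₃ L) ∧ 0 < DNLS.betaParam ω c (η₃ L) ∧
        2 * L = 4 * DNLS.gParam ω c (η₃ L) * DNLS.ellipticK (DNLS.modulus ω c (η₃ L)) ∧
        -- the explicit representation
        (∀ x : ℝ, Φ L x ^ 2 =
          η₃ L *
            (DNLS.jacobiDn (x / (2 * DNLS.gParam ω c (η₃ L))) (DNLS.modulus ω c (η₃ L)) ^ 2 /
              (1 + DNLS.betaParam ω c (η₃ L) ^ 2 *
                DNLS.jacobiSn (x / (2 * DNLS.gParam ω c (η₃ L)))
                  (DNLS.modulus ω c (η₃ L)) ^ 2)))) ∧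
      -- the long-period limit
      (∀ x : ℝ, Tendsto (fun L : ℝ => Φ L x) atTop (𝓝 (DNLS.soliton ω c x))) := by
  -- For `L ≤ L₀` the value `η L` is unconstrained; the limit only involves large `L`.
  choose! η hmem hη using fun L (hL : L0 ω c < L) => exists_halfPeriod_eq hωc hL
  refine ⟨L0_pos hωc, fun L => dnoidal ω c (η L), η, fun L hL => ?_, fun x => ?_⟩
  · have hx := hmem L hL
    have h0 := (alpha0_pos hωc).trans hx.1
    refine ⟨?_, fun Ψ hΨ => ?_, hx.1, (soliton_zero_sq hωc).symm ▸ hx.2, eta1_neg hωc h0 hx.2,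
      eta2_pos hωc h0 hx.2, eta2_lt hωc hx.1, modulus_pos hωc hx.1 hx.2,
      modulus_lt_one hωc hx.1.le hx.2, gParam_pos hωc hx.1.le hx.2,
      Real.sqrt_pos.2 (betaParam_arg_pos hωc hx.1 hx.2), ?_, fun t => ?_⟩
    · simpa only [hη L hL] using dnoidal_isPositiveSingleBumpSolution hωc hx
    · obtain ⟨y, hy, hyL, a, ha⟩ := hΨ.exists_eq_dnoidal hωc
      -- Injectivity of the half-period forces the same largest root, leaving only the translation
      -- free.
      have : y = η L := (halfPeriod_strictMonoOn hωc).injOn ⟨hy.1.le, hy.2⟩ ⟨hx.1.le, hx.2⟩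
        (hyL.trans (hη L hL).symm)
      exact ⟨a, fun t => (ha t).trans (by rw [this])⟩
    · nth_rewrite 1 [← hη L hL]
      rw [halfPeriod]
      ring
    · exact Real.sq_sqrt (Real.sqrt_pos.1 (dnoidal_pos hωc hx t)).le
  · refine tendsto_dnoidal hωc ?_
      (tendsto_solitonPeak_of_halfPeriod_eq hωc fun L hL => ⟨hmem L hL, hη L hL⟩) x
    filter_upwards [eventually_gt_atTop (L0 ω c)] with L hL using hmem L hL
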